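/- **Setting.** Scalars are complex. For a set $A$ let $\Omega_A=\{-1,1\}^A$, $\mathbb P_A$ the uniform (product) probability measure on $\Omega_A$, $r_\alpha(\omega)=\omega(\alpha)$ the Rademacher characters, $R_A=\{r_\alpha\}_{\alpha\in A}$, $W_A=\{\prod_{\alpha\in F}r_\alpha: F\subset A \text{ finite}\}$ the Walsh system, $r_0\equiv 1$, $\widehat f(w)=\int f\,\overline w\,d\mathbb P_A$ for $w\in W_A$, and $U_{R_A}\mathbf x=\sum_{\alpha}\mathbf x(\alpha)r_\alpha$ (in $L^2$) for $\mathbf x\in l^2(A)$. Write $\mathcal S_{l^2(A)}$ for the unit sphere of $l^2(A)$, $\boldsymbol\sigma\mathbf x=\mathbf x/\|\mathbf x\|_2$ for $\mathbf x\ne 0$, $\mathbf x\cdot\mathbf y=\sum_\alpha \mathbf x(\alpha)\mathbf y(\alpha)$, and $\|\Phi\|_{l^2\hookrightarrow L^\infty}=\sup\{\|\Phi(\mathbf x)\|_{L^\infty}:\mathbf x\in\mathcal S_{l^2(A)}\}$. For $\delta\ge 0$ put $$\beta_R(\delta)=\sup_A\ \sup_{\mathbf x\in\mathcal S_{l^2(A)}}\inf\{\|g\|_{L^\infty}: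 g\in L^\infty(\Omega_A,\mathbb P_A),\ \widehat g(r_\alpha)=\mathbf x(\alpha)\ (\alpha\in A),\ \|g-U_{R_A}\mathbf x\|_{L^2}\le\delta\}\in[0,\infty].$$ For $A'\supset A$, a map $G:l^2(A)\to L^\infty(\Omega_{A'},\mathbb P_{A'})$ is an *interpolant on $R_A$* if it is injective, $G(\mathbf 0)=0$, $G(\mathbf x)=\|\mathbf x\|_2\,G(\boldsymbol\sigma\mathbf x)$ for $\mathbf x\neq\mathbf 0$, and $\widehat{G(\mathbf x)}(r_\alpha)=\mathbf x(\alpha)$ for all $\mathbf x\in l^2(A)$, $\alpha\in A$. It is an *ultra-interpolant on $R_A$* if moreover $\int G(\mathbf x)\,G(\mathbf y)\,d\mathbb P_{A'}=\mathbf x\cdot\mathbf y$ for all $\mathbf x,\mathbf y\in l^2(A)$, and $\|G\|_{l^2\hookrightarrow L^\infty}<\infty$. Given $A$, let $A_1=A$, $A_{j+1}=W_{A_j}\setminus(R_{A_j}\cup\{r_0\})$ (the $A_j$ taken disjoint), $A'=\bigcup_{j\ge1}A_j$, and let $\pi_{A_j}:\Omega_{A'}\to\Omega_{A_j}$ be the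 restriction maps. For $\delta\in(0,1)$, an *admissible selection* is a sequence of interpolants $G_{A_j,\delta}:l^2(A_j)\to L^\infty(\Omega_{A_j},\mathbb P_{A_j})$ on $R_{A_j}$, $j\ge1$, such that for all $j\ge 1$ and $\mathbf x\in l^2(A_j)$, with $\mathfrak p_{A_j,\delta}(\mathbf x)=G_{A_j,\delta}(\mathbf x)-U_{R_{A_j}}\mathbf x$, $$\|G_{A_j,\delta}(\mathbf x)\|_{L^\infty}\le\beta_R(\delta)\|\mathbf x\|_2,\qquad \|\mathfrak p_{A_j,\delta}(\mathbf x)\|_{L^2}\le\delta\|\mathbf x\|_2,\qquad \int G_{A_j,\delta}(\mathbf x)\,d\mathbb P_{A_j}=0 .$$ Put $G_{j,\delta}(\mathbf x)=G_{A_j,\delta}(\mathbf x)\circ\pi_{A_j}$. For $\mathbf x\in l^2(A)$ let $\mathbf x^{(1)}=\mathbf x$ and $\mathbf x^{(j+1)}(w)=\widehat{\mathfrak p_{A_j,\delta}(\mathbf x^{(j)})}(w)$ for $w\in A_{j+1}$. **Theorem 4.1.** Let $\delta\in(0,1)$ and let $A$ be any set. Then $\beta_R(\delta)<\infty$ and admissible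 selections exist. For every admissible selection, the series $$\Phi_{A,\delta}(\mathbf x)=\sum_{j=1}^\infty \mathfrak i^{\,j-1}G_{j,\delta}(\mathbf x^{(j)}),\qquad \mathbf x\in l^2(A)\quad(\mathfrak i=\sqrt{-1}),$$ converges absolutely in $L^\infty(\Omega_{A'},\mathbb P_{A'})$; both the series and the series of the norms of its terms converge uniformly on bounded subsets of $l^2(A)$. Moreover, $\Phi_{A,\delta}$ is an ultra-interpolant on $R_A$ with values in $L^\infty(\Omega_{A'},\mathbb P_{A'})$, and $$\|\Phi_{A,\delta}\|_{l^2\hookrightarrow L^\infty}\le\frac{\beta_R(\delta)}{1-\delta}.$$ -/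

import Mathlib

open MeasureTheory Filter Topology
open scoped ENNReal

universe u

namespace UltraInterp

noncomputable section

/-! ### The dyadic group `Ω_A = {-1,1}^A`, its uniform probability measure, and Walsh characters -/

/-- `Ω_A = {-1,1}^A`; the two elements of `ℤˣ` are `1` and `-1`. -/
abbrev Omega (A : Type u) : Type u := A → ℤˣ

/-- The uniform probability measure on `{-1,1}`. -/
def coin : Measure ℤˣ := (2⁻¹ : ℝ≥0∞) • (Measure.dirac 1 + Measure.dirac (-1))

instance : IsProbabilityMeasure coin := by
  constructor
  simp [coin, ENNReal.inv_two_add_inv_two]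

/-- The uniform probability measure `ℙ_A` on `Ω_A` (product of fair coins). -/
def P (A : Type u) : Measure (Omega A) := Measure.infinitePi fun _ : A => coin

instance (A : Type u) : IsProbabilityMeasure (P A) := by
  unfold P; infer_instance

/-- The space `l²(A)` of square summable complex functions on `A`. -/
abbrev Seq2 (A : Type u) : Type u := lp (fun _ : A => ℂ) 2

/-- The space `L^∞(Ω_A, ℙ_A)` (complex valued, modulo a.e. equality). -/
abbrev LInf (A : Type u) := Lp ℂ ∞ (P A)

/-- The Rademacher character `r_α(ω) = ω(α)`. -/
def rad {A : Type u} (α : A) (ω : Omega A) : ℂ := ((ω α : ℤ) : ℂ)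

/-- The Walsh character `∏_{α ∈ F} r_α`. The Walsh system `W_A` consists of these characters,
`F` ranging over the finite subsets of `A`; by `walsh_injective` below it is indexed faithfully by
`Finset A`. The empty set gives `r_0 ≡ 1`, the singletons give the Rademacher system `R_A`. -/
def walsh {A : Type u} (F : Finset A) (ω : Omega A) : ℂ := ∏ α ∈ F, rad α ω

/-- The Walsh transform `f^(w) = ∫ f w̄ dℙ_A` at the character `w = walsh F`. -/
def fourier {A : Type u} (f : Omega A → ℂ) (F : Finset A) : ℂ :=
  ∫ ω, f ω * (starRingEnd ℂ) (walsh F ω) ∂(P A)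

theorem walsh_empty {A : Type u} (ω : Omega A) : walsh (∅ : Finset A) ω = 1 := by
  simp [walsh]

theorem walsh_singleton {A : Type u} (α : A) (ω : Omega A) : walsh {α} ω = rad α ω := by
  simp [walsh]

theorem walsh_mul_self {A : Type u} (F : Finset A) (ω : Omega A) :
    walsh F ω * walsh F ω = 1 := by
  unfold walsh rad
  rw [← Finset.prod_mul_distrib]
  refine Finset.prod_eq_one fun α _ => ?_
  rcases Int.units_eq_one_or (ω α) with h | h <;> simp [h]

theorem conj_walsh {A : Type u} (F : Finset A) (ω : Omega A) :
    (starRingEnd ℂ) (walsh F ω) = walsh F ω := by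
  simp [walsh, rad]

theorem norm_walsh {A : Type u} (F : Finset A) (ω : Omega A) : ‖walsh F ω‖ = 1 := by
  have h := congrArg norm (walsh_mul_self F ω)
  rw [norm_mul, norm_one] at h
  nlinarith [norm_nonneg (walsh F ω)]

theorem measurable_walsh {A : Type u} (F : Finset A) : Measurable (walsh F) := by
  unfold walsh rad
  refine Finset.measurable_prod _ fun α _ => ?_
  exact (Measurable.of_discrete (f := fun z : ℤ => (z : ℂ))).comp
    ((comap_measurable Units.val).comp (measurable_pi_apply α))

/-- Change of the sign of the coordinate `α`. -/
def flipCoord {A : Type u} (α : A) (ω : Omega A) : Omega A :=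
  open Classical in fun β => if β = α then -ω β else ω β

theorem measurable_unitsVal : Measurable (Units.val : ℤˣ → ℤ) := comap_measurable _

instance : DiscreteMeasurableSpace ℤˣ where
  forall_measurableSet s := ⟨Units.val '' s, MeasurableSet.of_discrete,
    Set.preimage_image_eq s Units.val_injective⟩

theorem measurePreserving_neg_coin : MeasurePreserving (fun z : ℤˣ => -z) coin coin := by
  refine ⟨Measurable.of_discrete, ?_⟩
  rw [coin, Measure.map_smul, Measure.map_add _ _ Measurable.of_discrete,
    Measure.map_dirac' Measurable.of_discrete, Measure.map_dirac' Measurable.of_discrete, neg_neg,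
    add_comm]

theorem measurePreserving_flipCoord {A : Type u} (α : A) :
    MeasurePreserving (flipCoord α) (P A) (P A) := by
  classical
  have hm : ∀ β : A, Measurable (fun z : ℤˣ => if β = α then -z else z) :=
    fun β => Measurable.of_discrete
  refine ⟨?_, ?_⟩
  · refine measurable_pi_lambda _ fun β => ?_
    have := (hm β).comp (measurable_pi_apply (X := fun _ : A => ℤˣ) β)
    simpa [flipCoord, Function.comp_def] using this
  · have h := Measure.infinitePi_map_pi (μ := fun _ : A => coin)
      (f := fun β (z : ℤˣ) => if β = α then -z else z) hm
    have h2 : (fun β : A => coin.map (fun z : ℤˣ => if β = α then -z else z)) =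
        fun _ => coin := by
      funext β
      by_cases hb : β = α
      · simpa [hb] using measurePreserving_neg_coin.map_eq
      · simp [hb]
    rw [h2] at h
    unfold P
    convert h using 2
    funext ω β
    simp [flipCoord]

theorem walsh_flip {A : Type u} (α : A) (F : Finset A) (ω : Omega A) :
    walsh F (flipCoord α ω) = (open Classical in if α ∈ F then -1 else 1) * walsh F ω := by
  classical
  have hr : ∀ β, rad β (flipCoord α ω) = (if β = α then -1 else 1) * rad β ω := by
    intro β
    by_cases hb : β = α <;> simp [rad, flipCoord, hb]
  unfold walsh
  simp only [hr, Finset.prod_mul_distrib]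
  congr 1
  rw [Finset.prod_ite_eq']

/-- Distinct finite sets give distinct characters. -/
theorem walsh_injective {A : Type u} : Function.Injective (walsh : Finset A → Omega A → ℂ) := by
  classical
  intro F F' h
  ext α
  have h1 := walsh_flip α F 1
  have h2 := walsh_flip α F' 1
  have ho : ∀ E : Finset A, walsh E (1 : Omega A) = 1 := fun E => by simp [walsh, rad]
  rw [← h, h1, ho] at h2
  by_cases ha : α ∈ F <;> by_cases hb : α ∈ F' <;> simp [ha, hb] at h2 ⊢ <;> norm_num at h2

theorem integral_walsh_mul {A : Type u} {F F' : Finset A} (h : F ≠ F') :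
    ∫ ω, walsh F ω * walsh F' ω ∂(P A) = 0 := by
  classical
  obtain ⟨α, hα⟩ : ∃ α, ¬ (α ∈ F ↔ α ∈ F') := by
    by_contra hc
    push Not at hc
    exact h (Finset.ext hc)
  have key : ∀ ω : Omega A, walsh F (flipCoord α ω) * walsh F' (flipCoord α ω) =
      -(walsh F ω * walsh F' ω) := by
    intro ω
    rw [walsh_flip, walsh_flip]
    by_cases ha : α ∈ F <;> by_cases hb : α ∈ F' <;> simp_all
  have hmp := measurePreserving_flipCoord α
  have h1 : ∫ ω, walsh F ω * walsh F' ω ∂(P A) =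
      ∫ ω, walsh F (flipCoord α ω) * walsh F' (flipCoord α ω) ∂(P A) := by
    conv_lhs => rw [← hmp.map_eq]
    exact integral_map hmp.measurable.aemeasurable
      ((measurable_walsh F).mul (measurable_walsh F')).aestronglyMeasurable
  simp only [key, integral_neg] at h1
  have h2 : (2 : ℂ) * ∫ ω, walsh F ω * walsh F' ω ∂(P A) = 0 := by
    linear_combination h1
  simpa using h2

theorem memLp_walsh {A : Type u} (F : Finset A) (p : ℝ≥0∞) : MemLp (walsh F) p (P A) :=
  MemLp.of_bound (measurable_walsh F).aestronglyMeasurable 1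
    (Eventually.of_forall fun ω => (norm_walsh F ω).le)

/-- A Walsh character as an element of `L²(Ω_A, ℙ_A)`. -/
def walsh2 {A : Type u} (F : Finset A) : Lp ℂ 2 (P A) := (memLp_walsh F 2).toLp _

theorem inner_walsh2 {A : Type u} (F : Finset A) {f : Omega A → ℂ} (hf : MemLp f 2 (P A)) :
    inner ℂ (walsh2 F) (hf.toLp f) = fourier f F := by
  rw [L2.inner_def, fourier]
  refine integral_congr_ae ?_
  filter_upwards [(memLp_walsh F 2).coeFn_toLp, hf.coeFn_toLp] with ω h1 h2
  rw [walsh2, h1, h2]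
  rfl

theorem orthonormal_walsh2 (A : Type u) :
    Orthonormal ℂ (walsh2 : Finset A → Lp ℂ 2 (P A)) := by
  classical
  rw [orthonormal_iff_ite]
  intro F F'
  have h := inner_walsh2 F (memLp_walsh F' 2)
  change inner ℂ (walsh2 F) (walsh2 F') = _ at h
  rw [h, fourier]
  simp only [conj_walsh]
  by_cases hF : F = F'
  · subst hF
    simp [walsh_mul_self]
  · rw [integral_walsh_mul (Ne.symm hF), if_neg hF]

/-- The map `U_{R_A} : l²(A) → L²(Ω_A, ℙ_A)`, `x ↦ ∑_α x(α) r_α` (series in `L²`). -/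
def U {A : Type u} (x : Seq2 A) : Lp ℂ 2 (P A) := ∑' α, (x α) • walsh2 {α}

theorem hasSum_U {A : Type u} (x : Seq2 A) : HasSum (fun α => (x α) • walsh2 {α}) (U x) := by
  have ho : Orthonormal ℂ (fun α : A => walsh2 ({α} : Finset A)) :=
    (orthonormal_walsh2 A).comp _ Finset.singleton_injective
  exact (ho.orthogonalFamily.summable_of_lp x).hasSum

theorem memLp_two {A : Type u} (g : LInf A) : MemLp g 2 (P A) :=
  (Lp.memLp g).mono_exponent le_top

/-- The perturbation `g - U_{R_A} x`. -/
def pert {A : Type u} (g : LInf A) (x : Seq2 A) : Omega A → ℂ := fun ω => g ω - U x ω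

theorem memLp_pert {A : Type u} (g : LInf A) (x : Seq2 A) : MemLp (pert g x) 2 (P A) :=
  (memLp_two g).sub (Lp.memLp (U x))

/-! ### The modulus `β_R` -/

/-- The set of `g ∈ L^∞(Ω_A, ℙ_A)` with `g^(r_α) = x(α)` for all `α` and
`‖g - U_{R_A} x‖_{L²} ≤ δ`. -/
def interpSet {A : Type u} (δ : ℝ) (x : Seq2 A) : Set (LInf A) :=
  {g | (∀ α, fourier g {α} = x α) ∧ eLpNorm (pert g x) 2 (P A) ≤ ENNReal.ofReal δ}

/-- `β(A, δ)`: supremum over the unit sphere of `l²(A)` of the infimum of `‖g‖_{L^∞}` over the set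
above, in `[0, ∞]` (the infimum over the empty set is `∞`). -/
def beta (A : Type u) (δ : ℝ) : ℝ≥0∞ :=
  ⨆ x ∈ Metric.sphere (0 : Seq2 A) 1, ⨅ g ∈ interpSet δ x, ‖g‖ₑ

/-- The `Λ(2)`-modulus of Rademacher systems: the supremum of `β(A, δ)` over all sets `A`. -/
def betaR (δ : ℝ) : ℝ≥0∞ := ⨆ A : Type u, beta A δ

/-! ### Interpolants, representations, ultra-interpolants -/

/-- `σ x = x / ‖x‖₂` for `x ≠ 0`, and `σ 0 = 0`. -/
def sigma {A : Type u} (x : Seq2 A) : Seq2 A := ((‖x‖⁻¹ : ℝ) : ℂ) • x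

/-- The norm `‖Φ‖ = sup {‖Φ(x)‖ : ‖x‖₂ = 1}`, in `[0, ∞]`. -/
def supNorm {A : Type u} {Y : Type*} [NormedAddCommGroup Y] (Φ : Seq2 A → Y) : ℝ≥0∞ :=
  ⨆ x ∈ Metric.sphere (0 : Seq2 A) 1, ‖Φ x‖ₑ

/-- `(l²(A) ↪ L^∞(Ω_{A'}, ℙ_{A'}))`-interpolants on `R_A`, where `A` is viewed as a subset of `A'`
through `ι`. -/
structure IsInterpolant {A A' : Type u} (ι : A ↪ A') (G : Seq2 A → LInf A') : Prop where
  injective : Function.Injective G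
  map_zero : G 0 = 0
  homog : ∀ x, x ≠ 0 → G x = (‖x‖ : ℂ) • G (sigma x)
  interp : ∀ x α, fourier (G x) {ι α} = x α

/-- `L^∞`-representations of `l²(A)` on a probability space; the pairing `∑_α x(α) y(α)` is the
bilinear dot product. -/
structure IsRepresentation {A : Type u} {Ω : Type*} [MeasurableSpace Ω] {μ : Measure Ω}
    (Φ : Seq2 A → Lp ℂ ∞ μ) : Prop where
  injective : Function.Injective Φ
  map_zero : Φ 0 = 0
  homog : ∀ x, x ≠ 0 → Φ x = (‖x‖ : ℂ) • Φ (sigma x)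
  parseval : ∀ x y, HasSum (fun α => x α * y α) (∫ ω, Φ x ω * Φ y ω ∂μ)
  bounded : supNorm Φ < ∞

/-- Ultra-interpolants: interpolants that are also representations. -/
def IsUltraInterpolant {A A' : Type u} (ι : A ↪ A') (Φ : Seq2 A → LInf A') : Prop :=
  IsInterpolant ι Φ ∧ IsRepresentation Φ

/-! ### The set-cascade, the vector-cascade, and the series -/

/-- `W_B ∖ (R_B ∪ {r_0})`: the Walsh characters of order at least two. -/
abbrev Next (B : Type u) : Type u := {F : Finset B // 2 ≤ F.card}

/-- The set-cascade generated by `A`, indexed from `0`: `cascade A j` is `A_{j+1}`. -/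
def cascade (A : Type u) : ℕ → Type u
  | 0 => A
  | j + 1 => Next (cascade A j)

/-- The disjoint union `A'` of the set-cascade. -/
abbrev Limit (A : Type u) : Type u := Σ j, cascade A j

/-- The inclusion of the `j`-th set of the cascade into `A'`. -/
def incl (A : Type u) (j : ℕ) : cascade A j ↪ Limit A := ⟨Sigma.mk j, sigma_mk_injective⟩

/-- The inclusion of `A`, the first set of the cascade, into `A'`. -/
def base (A : Type u) : A ↪ Limit A := incl A 0

/-- The projection `π : Ω_{A'} → Ω_B` that restricts `ω` to a subset `B` of `A'`. -/
def proj {B A' : Type u} (ι : B ↪ A') (ω : Omega A') : Omega B := fun b => ω (ι b)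

theorem measurePreserving_proj {B A' : Type u} (ι : B ↪ A') :
    MeasurePreserving (proj ι) (P A') (P B) := by
  classical
  have hm : Measurable (proj ι) := measurable_pi_lambda _ fun b => measurable_pi_apply (ι b)
  refine ⟨hm, ?_⟩
  refine Measure.eq_infinitePi _ fun s t ht => ?_
  have ht' : MeasurableSet (Set.pi (s : Set B) t) :=
    MeasurableSet.pi s.countable_toSet fun i _ => ht i
  rw [Measure.map_apply hm ht']
  have hpre : proj ι ⁻¹' (Set.pi (s : Set B) t) =
      Set.pi ((s.map ι : Finset A') : Set A') (fun a => {z | ∀ b, ι b = a → z ∈ t b}) := by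
    ext ω
    simp only [Set.mem_preimage, Set.mem_pi, proj, Finset.coe_map, Set.mem_image,
      Finset.mem_coe, Set.mem_ofPred_eq]
    constructor
    · rintro h a ⟨b, hb, rfl⟩ c hc
      rw [ι.injective hc]
      exact h b hb
    · intro h b hb
      exact h (ι b) ⟨b, hb, rfl⟩ b rfl
  rw [hpre, P, Measure.infinitePi_pi _ fun _ _ => MeasurableSet.of_discrete, Finset.prod_map]
  refine Finset.prod_congr rfl fun b _ => ?_
  congr 1
  ext z
  constructor
  · exact fun h => h b rfl
  · intro h c hc
    rw [ι.injective hc]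
    exact h

/-- `g ↦ g ∘ π`, from `L^∞(Ω_B)` to `L^∞(Ω_{A'})`. -/
def lift {B A' : Type u} (ι : B ↪ A') (g : LInf B) : LInf A' :=
  Lp.compMeasurePreserving (proj ι) (measurePreserving_proj ι) g

theorem memℓp_fourier {B : Type u} {f : Omega B → ℂ} (hf : MemLp f 2 (P B)) :
    Memℓp (fun F : Next B => fourier f F.1) 2 := by
  have ho : Orthonormal ℂ (fun F : Next B => walsh2 F.1) :=
    (orthonormal_walsh2 B).comp _ Subtype.val_injective
  have h := ho.inner_products_summable (x := hf.toLp f)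
  simp only [inner_walsh2] at h
  refine memℓp_gen ?_
  simpa using h

/-- One step of the vector-cascade: from `x ∈ l²(B)` and `g ∈ L^∞(Ω_B, ℙ_B)`, the restriction of the
transform of `g - U_{R_B} x` to `W_B ∖ (R_B ∪ {r_0})`. -/
def nextVec {B : Type u} (g : LInf B) (x : Seq2 B) : Seq2 (Next B) :=
  ⟨fun F => fourier (pert g x) F.1, memℓp_fourier (memLp_pert g x)⟩

/-- The vector-cascade generated by `x ∈ l²(A)` and maps `G j : l²(A_j) → L^∞(Ω_{A_j})`. -/
def vec {A : Type u} (G : ∀ j, Seq2 (cascade A j) → LInf (cascade A j)) (x : Seq2 A) :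
    ∀ j, Seq2 (cascade A j)
  | 0 => x
  | j + 1 => nextVec (G j (vec G x j)) (vec G x j)

/-- The admissible selections: for every `j`, `G j` is an interpolant
`U_{R_{A_j}} + 𝔭_{A_j,δ} : l²(A_j) → L^∞(Ω_{A_j}, ℙ_{A_j})` bounded by `β_R(δ)`, with mean zero
values, whose perturbation is bounded by `δ` in `L²`. -/
structure IsSelection (A : Type u) (δ : ℝ)
    (G : ∀ j, Seq2 (cascade A j) → LInf (cascade A j)) : Prop where
  interpolant : ∀ j, IsInterpolant (Function.Embedding.refl _) (G j)
  norm_le : ∀ j x, ‖G j x‖ₑ ≤ betaR.{u} δ * ‖x‖ₑ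
  pert_le : ∀ j x, eLpNorm (pert (G j x) x) 2 (P (cascade A j)) ≤ ENNReal.ofReal δ * ‖x‖ₑ
  mean_zero : ∀ j x, ∫ ω, G j x ω ∂(P (cascade A j)) = 0

/-- The terms `𝔦^{j-1} G_{j,δ}(x^{(j)})` of the cascade series (with `j` counted from `0`),
where `G_{j,δ}(x) = G_{A_j,δ}(x) ∘ π_{A_j}`. -/
def seriesTerm {A : Type u} (G : ∀ j, Seq2 (cascade A j) → LInf (cascade A j)) (j : ℕ) (x : Seq2 A) :
    LInf (Limit A) :=
  Complex.I ^ j • lift (incl A j) (G j (vec G x j))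

/-- The sum `Φ_{A,δ}(x)` of the cascade series in `L^∞(Ω_{A'}, ℙ_{A'})`. -/
def Phi {A : Type u} (G : ∀ j, Seq2 (cascade A j) → LInf (cascade A j)) (x : Seq2 A) :
    LInf (Limit A) :=
  ∑' j, seriesTerm G j x

end

end UltraInterp

open UltraInterp

namespace UltraInterp

noncomputable section

/-! Finiteness of `betaR δ` comes from Riesz products. For real `y` in the unit ball and `0 < s ≤
1`, the product of the factors `1 + 𝔦 s y(α) r_α` has modulus `∏ (1 + s² y(α)²)^{1/2}`, bounded
independently of `A`. Removing its mean and dividing by `𝔦 s` leaves the coefficient `y(α)` at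
`r_α`, while the coefficients of order at least two have `l²` norm `O(s)`. A complex vector is split
into real and imaginary parts, and `s` is taken proportional to `δ` (`betaR_lt_top`).

A selection must be bounded by `betaR δ` itself, so the infimum has to be attained. In `L²`, the
interpolants of `x` bounded by `C` form a closed convex set that shrinks as `C` decreases to `betaR
δ`, and nested bounded closed convex sets in a Hilbert space have a common point
(`nonempty_iInter_of_convex`). Taking odd parts makes the mean vanish at no cost
(`oddPart_mem_interpSet2`), and radial extension from the sphere gives the maps of a selection.

For the series, Parseval turns the pairing of two mean-zero interpolants into `x·y` plus the dot
product of the next vectors (`integral_mul_eq_dot_add_dot`). Terms at different levels depend on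
disjoint coordinates and are orthogonal. Since the pairing is bilinear, the powers of `𝔦` give
alternating signs, so the pairing of partial sums telescopes to `x·y` with a remainder
(`pairing_partial_sums`). Each step of the vector-cascade contracts by `δ`, which kills the
remainder and makes the series geometric. Only the level-0 term involves the coordinates in `A`, so
the sum interpolates `x`. -/

theorem seq2_add_apply {A : Type u} (x y : Seq2 A) (α : A) : (x + y) α = x α + y α := rfl

theorem seq2_sub_apply {A : Type u} (x y : Seq2 A) (α : A) : (x - y) α = x α - y α := rfl

theorem seq2_smul_apply {A : Type u} (c : ℂ) (x : Seq2 A) (α : A) : (c • x) α = c * x α := rfl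

theorem seq2_star_apply {A : Type u} (x : Seq2 A) (α : A) :
    (star x) α = (starRingEnd ℂ) (x α) := rfl

/-! ### Completeness of the Walsh system -/

/-- The set of sign patterns that are `1` on the finite set `F`. -/
def cyl {A : Type u} (F : Finset A) : Set (Omega A) := {ω | ∀ a ∈ F, ω a = 1}

theorem measurableSet_cyl {A : Type u} (F : Finset A) : MeasurableSet (cyl F) := by
  have : cyl F = ⋂ a ∈ F, (fun ω : Omega A => ω a) ⁻¹' {1} := by
    ext ω; simp [cyl]
  rw [this]
  exact F.measurableSet_biInter fun a _ => measurable_pi_apply a (MeasurableSet.of_discrete)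

/-- A coordinate takes only two values, so the event that it equals `1`, with its complement,
determines it. -/
theorem generateFrom_cyl (A : Type u) :
    (MeasurableSpace.pi : MeasurableSpace (Omega A)) =
      MeasurableSpace.generateFrom (Set.range (cyl (A := A))) := by
  apply le_antisymm
  · refine iSup_le fun a => ?_
    rw [← measurable_iff_comap_le]
    have h1 : MeasurableSet[MeasurableSpace.generateFrom (Set.range (cyl (A := A)))]
        ((fun ω : Omega A => ω a) ⁻¹' {1}) := by
      refine MeasurableSpace.measurableSet_generateFrom ⟨{a}, ?_⟩
      ext ω; simp [cyl]
    refine @measurable_to_countable' _ _ _ _ (_) _ fun z => ?_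
    rcases Int.units_eq_one_or z with rfl | rfl
    · exact h1
    · convert h1.compl using 1
      ext ω
      rcases Int.units_eq_one_or (ω a) with h | h <;> simp [h]
  · refine MeasurableSpace.generateFrom_le ?_
    rintro _ ⟨F, rfl⟩
    exact measurableSet_cyl F

theorem isPiSystem_cyl (A : Type u) : IsPiSystem (Set.range (cyl (A := A))) := by
  classical
  rintro _ ⟨F, rfl⟩ _ ⟨E, rfl⟩ _
  refine ⟨F ∪ E, ?_⟩
  ext ω
  simp only [cyl, Finset.mem_union, Set.mem_inter_iff, Set.mem_ofPred_eq]
  grind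

/-- The indicator of `ω a = 1` is `(1 + r_a)/2`; the product over `F` expands into Walsh characters.
Hence vanishing Walsh coefficients force vanishing integrals over cylinders. -/
theorem indicator_cyl {A : Type u} (F : Finset A) (ω : Omega A) :
    (cyl F).indicator (fun _ => (1 : ℂ)) ω = 2⁻¹ ^ F.card * ∑ E ∈ F.powerset, walsh E ω := by
  classical
  have h : ∑ E ∈ F.powerset, walsh E ω = ∏ a ∈ F, (1 + rad a ω) := by
    rw [Finset.prod_one_add]; rfl
  rw [h, ← Finset.prod_const, ← Finset.prod_mul_distrib]
  by_cases hω : ω ∈ cyl F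
  · rw [Set.indicator_of_mem hω]
    symm
    refine Finset.prod_eq_one fun a ha => ?_
    rw [rad, hω a ha]; norm_num
  · rw [Set.indicator_of_notMem hω]
    simp only [cyl, Set.mem_ofPred_eq, not_forall] at hω
    obtain ⟨a, ha, hne⟩ := hω
    symm
    refine Finset.prod_eq_zero ha ?_
    rw [rad, (Int.units_eq_one_or (ω a)).resolve_left hne]; norm_num

theorem integrable_mul_walsh {A : Type u} {f : Omega A → ℂ} (hf : Integrable f (P A))
    (F : Finset A) : Integrable (fun ω => f ω * walsh F ω) (P A) :=
  hf.mul_bdd (c := 1) (measurable_walsh F).aestronglyMeasurable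
    (Eventually.of_forall fun ω => (norm_walsh F ω).le)

theorem fourier_eq {A : Type u} (f : Omega A → ℂ) (F : Finset A) :
    fourier f F = ∫ ω, f ω * walsh F ω ∂(P A) := by
  simp only [fourier, conj_walsh]

theorem setIntegral_cyl_eq_zero {A : Type u} {f : Omega A → ℂ} (hf : Integrable f (P A))
    (h : ∀ F, fourier f F = 0) (F : Finset A) : ∫ ω in cyl F, f ω ∂(P A) = 0 := by
  rw [← integral_indicator (measurableSet_cyl F)]
  have : (cyl F).indicator f = fun ω => 2⁻¹ ^ F.card * ∑ E ∈ F.powerset, f ω * walsh E ω := by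
    funext ω
    rw [← Finset.mul_sum, mul_left_comm, ← indicator_cyl]
    by_cases hω : ω ∈ cyl F <;> simp [hω]
  rw [this, integral_const_mul, integral_finsetSum _ fun E _ => integrable_mul_walsh hf E]
  simp only [← fourier_eq, h, Finset.sum_const_zero, mul_zero]

/-- A π-λ argument: the sets over which `f` integrates to zero include the generating π-system of
cylinders and are stable under complements and disjoint unions. -/
theorem ae_eq_zero_of_fourier_eq_zero {A : Type u} {f : Omega A → ℂ} (hf : Integrable f (P A))
    (h : ∀ F, fourier f F = 0) : f =ᵐ[P A] 0 := by
  refine hf.ae_eq_zero_of_forall_setIntegral_eq_zero fun s hs _ => ?_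
  -- The cylinder over the empty set is the whole space; the complement case needs this.
  have huniv : ∫ ω, f ω ∂(P A) = 0 := by
    have := setIntegral_cyl_eq_zero hf h ∅
    simpa [cyl] using this
  induction s, hs using MeasurableSpace.induction_on_inter (generateFrom_cyl A)
    (isPiSystem_cyl A) with
  | empty => simp
  | basic t ht => obtain ⟨F, rfl⟩ := ht; exact setIntegral_cyl_eq_zero hf h F
  | compl t ht ih => rw [setIntegral_compl ht hf, ih (measure_lt_top _ _), huniv, sub_zero]
  | iUnion t hd hm ih =>
    rw [integral_iUnion hm hd hf.integrableOn]
    simp [ih _ (measure_lt_top _ _)]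

theorem fourier_congr {A : Type u} {f g : Omega A → ℂ} (h : f =ᵐ[P A] g) (F : Finset A) :
    fourier f F = fourier g F := by
  refine integral_congr_ae ?_
  filter_upwards [h] with ω hω
  rw [hω]

theorem inner_walsh2_Lp {A : Type u} (F : Finset A) (f : Lp ℂ 2 (P A)) :
    inner ℂ (walsh2 F) f = fourier f F := by
  rw [← inner_walsh2 F (Lp.memLp f), Lp.toLp_coeFn]

/-- The Walsh system as a Hilbert basis of `L²(Ω_A, ℙ_A)`. -/
def walshBasis (A : Type u) : HilbertBasis (Finset A) ℂ (Lp ℂ 2 (P A)) :=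
  HilbertBasis.mkOfOrthogonalEqBot (orthonormal_walsh2 A) (by
    rw [Submodule.eq_bot_iff]
    intro f hf
    have h : ∀ F, fourier f F = 0 := fun F => by
      rw [← inner_walsh2_Lp]
      exact (Submodule.mem_orthogonal _ _).1 hf _ (Submodule.subset_span ⟨F, rfl⟩)
    exact (Lp.eq_zero_iff_ae_eq_zero).2
      (ae_eq_zero_of_fourier_eq_zero ((Lp.memLp f).integrable (by norm_num)) h))

theorem walshBasis_apply {A : Type u} (F : Finset A) : walshBasis A F = walsh2 F := by
  simp [walshBasis]

theorem fourier_star {A : Type u} (f : Omega A → ℂ) (F : Finset A) :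
    fourier (star f) F = (starRingEnd ℂ) (fourier f F) := by
  rw [fourier, fourier, ← integral_conj]
  congr 1
  funext ω
  simp [conj_walsh]

/-- The bilinear Parseval formula for Walsh transforms. -/
theorem hasSum_fourier_mul {A : Type u} {f g : Omega A → ℂ} (hf : MemLp f 2 (P A))
    (hg : MemLp g 2 (P A)) :
    HasSum (fun F => fourier f F * fourier g F) (∫ ω, f ω * g ω ∂(P A)) := by
  -- Conjugating `f` undoes the conjugate-linearity of the inner product and gives a bilinear
  -- formula.
  have hs := (walshBasis A).hasSum_inner_mul_inner (hf.star.toLp _) (hg.toLp _)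
  simp only [walshBasis_apply, inner_walsh2] at hs
  have h1 : (fun F => fourier f F * fourier g F) =
      fun F => inner ℂ (hf.star.toLp _) (walsh2 F) * fourier g F := by
    funext F
    rw [← inner_conj_symm, inner_walsh2, fourier_star, Complex.conj_conj]
  have h2 : ∫ ω, f ω * g ω ∂(P A) = inner ℂ (hf.star.toLp _) (hg.toLp _) := by
    rw [L2.inner_def]
    refine integral_congr_ae ?_
    filter_upwards [hf.star.coeFn_toLp, hg.coeFn_toLp] with ω h1 h2
    rw [h1, h2]
    simp [mul_comm]
  rw [h1, h2]
  exact hs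

theorem hasSum_norm_fourier_sq {A : Type u} (f : Lp ℂ 2 (P A)) :
    HasSum (fun F => ‖fourier f F‖ ^ 2) (‖f‖ ^ 2) := by
  have hs := ((walshBasis A).hasSum_inner_mul_inner f f)
  simp only [walshBasis_apply] at hs
  rw [inner_self_eq_norm_sq_to_K] at hs
  have h2 : (fun F => inner ℂ f (walsh2 F) * inner ℂ (walsh2 F) f) =
      fun F => ((‖fourier f F‖ ^ 2 : ℝ) : ℂ) := by
    funext F
    rw [← inner_conj_symm, inner_walsh2_Lp, Complex.conj_mul']
    push_cast; rfl
  rw [h2] at hs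
  refine Complex.hasSum_ofReal.1 ?_
  rw [Complex.ofReal_pow]
  exact hs

theorem fourier_sub {A : Type u} {f g : Omega A → ℂ} (hf : Integrable f (P A))
    (hg : Integrable g (P A)) (F : Finset A) :
    fourier (fun ω => f ω - g ω) F = fourier f F - fourier g F := by
  simp only [fourier_eq, sub_mul]
  exact integral_sub (integrable_mul_walsh hf F) (integrable_mul_walsh hg F)

theorem fourier_smul {A : Type u} (c : ℂ) (f : Omega A → ℂ) (F : Finset A) :
    fourier (fun ω => c * f ω) F = c * fourier f F := by
  simp only [fourier_eq, mul_assoc]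
  exact integral_const_mul _ _

theorem fourier_walsh2 {A : Type u} [DecidableEq A] (E F : Finset A) :
    fourier (walsh2 E) F = if E = F then 1 else 0 := by
  rw [← inner_walsh2_Lp, orthonormal_iff_ite.1 (orthonormal_walsh2 A)]
  simp only [eq_comm]

theorem integrable_Lp2 {A : Type u} (f : Lp ℂ 2 (P A)) : Integrable f (P A) :=
  (Lp.memLp f).integrable (by norm_num)

theorem integrable_LInf {A : Type u} (f : LInf A) : Integrable f (P A) :=
  (Lp.memLp f).integrable le_top

/-! ### The Walsh transform of `U x` and of perturbations -/

theorem fourier_U_singleton {A : Type u} (x : Seq2 A) (α : A) : fourier (U x) {α} = x α := by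
  classical
  have h := (hasSum_U x).mapL (innerSL ℂ (walsh2 ({α} : Finset A)))
  simp only [innerSL_apply_apply, inner_smul_right, inner_walsh2_Lp, fourier_walsh2,
    Finset.singleton_inj] at h
  refine h.unique ?_
  have h2 : (fun β => x β * if β = α then (1 : ℂ) else 0) =
      fun β => if β = α then x α else 0 := by
    funext β
    split_ifs with hb <;> simp [hb]
  rw [h2]
  exact hasSum_ite_eq α (x α)

theorem fourier_U_of_card_ne {A : Type u} (x : Seq2 A) {F : Finset A} (hF : F.card ≠ 1) :
    fourier (U x) F = 0 := by
  classical
  have h := (hasSum_U x).mapL (innerSL ℂ (walsh2 F))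
  simp only [innerSL_apply_apply, inner_smul_right, inner_walsh2_Lp, fourier_walsh2] at h
  refine h.unique ?_
  convert hasSum_zero with β
  rw [if_neg, mul_zero]
  rintro rfl
  simp at hF

theorem fourier_pert {A : Type u} (g : LInf A) (x : Seq2 A) (F : Finset A) :
    fourier (pert g x) F = fourier g F - fourier (U x) F :=
  fourier_sub (integrable_LInf g) (integrable_Lp2 _) F

/-- `U x` has no coefficients of order two or more, so subtracting it is invisible here. -/
theorem nextVec_apply {B : Type u} (g : LInf B) (x : Seq2 B) (F : Next B) :
    nextVec g x F = fourier g F.1 := by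
  change fourier (pert g x) F.1 = _
  have := F.2
  rw [fourier_pert, fourier_U_of_card_ne _ (by omega), sub_zero]

theorem U_add {A : Type u} (x y : Seq2 A) : U (x + y) = U x + U y := by
  refine (hasSum_U (x + y)).unique ?_
  convert (hasSum_U x).add (hasSum_U y) using 2
  rw [lp.coeFn_add, Pi.add_apply, add_smul]

theorem U_smul {A : Type u} (c : ℂ) (x : Seq2 A) : U (c • x) = c • U x := by
  refine (hasSum_U (c • x)).unique ?_
  convert (hasSum_U x).const_smul c using 2
  rw [lp.coeFn_smul, Pi.smul_apply, smul_smul]; rfl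

/-! ### Essentially bounded elements of `L²` -/

/-- The elements of `L²` that are bounded by `C` almost everywhere. -/
def boundedSet {A : Type u} (C : ℝ) : Set (Lp ℂ 2 (P A)) := {f | ∀ᵐ ω ∂(P A), ‖f ω‖ ≤ C}

/-- An `L²`-convergent sequence has an a.e. convergent subsequence, along which the bound survives.
-/
theorem isClosed_boundedSet {A : Type u} (C : ℝ) : IsClosed (boundedSet (A := A) C) := by
  refine IsSeqClosed.isClosed fun f g hf hfg => ?_
  obtain ⟨ns, -, hns⟩ := (tendstoInMeasure_of_tendsto_Lp hfg).exists_seq_tendsto_ae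
  have hall : ∀ᵐ ω ∂(P A), ∀ n, ‖f n ω‖ ≤ C := ae_all_iff.2 hf
  filter_upwards [hns, hall] with ω h1 h2
  exact le_of_tendsto h1.norm (Eventually.of_forall fun n => h2 _)

theorem memLp_top_of_mem_boundedSet {A : Type u} {C : ℝ} {f : Lp ℂ 2 (P A)}
    (hf : f ∈ boundedSet C) : MemLp f ∞ (P A) :=
  memLp_top_of_bound (Lp.aestronglyMeasurable f) C hf

/-- A bounded element of `L²` as an element of `L^∞`. -/
theorem exists_LInf_of_mem_boundedSet {A : Type u} {C : ℝ} (hC : 0 ≤ C) {f : Lp ℂ 2 (P A)}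
    (hf : f ∈ boundedSet C) : ∃ g : LInf A, g =ᵐ[P A] f ∧ ‖g‖ ≤ C := by
  have hm := memLp_top_of_mem_boundedSet hf
  refine ⟨hm.toLp _, hm.coeFn_toLp, (Lp.norm_le_of_ae_bound hC ?_).trans_eq (b := _ * C) (by
    simp [measureUnivNNReal])⟩
  filter_upwards [hm.coeFn_toLp, hf] with ω h1 h2
  rwa [h1]

theorem LInf_ae_norm_le {A : Type u} (f : LInf A) : ∀ᵐ ω ∂(P A), ‖f ω‖ ≤ ‖f‖ := by
  have hb : ∀ᵐ ω ∂(P A), ‖f ω‖ₑ ≤ eLpNormEssSup f (P A) := ae_le_eLpNormEssSup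
  filter_upwards [hb] with ω h
  rwa [← eLpNorm_exponent_top, ← Lp.enorm_def, ← ofReal_norm, ← ofReal_norm,
    ENNReal.ofReal_le_ofReal_iff (norm_nonneg _)] at h

theorem pert_congr {A : Type u} {g : LInf A} {f : Lp ℂ 2 (P A)} (h : g =ᵐ[P A] f) (x : Seq2 A) :
    pert g x =ᵐ[P A] (f - U x : Lp ℂ 2 (P A)) := by
  filter_upwards [h, Lp.coeFn_sub f (U x)] with ω h1 h2
  rw [h2, pert, h1, Pi.sub_apply]

theorem eLpNorm_pert {A : Type u} {g : LInf A} {f : Lp ℂ 2 (P A)} (h : g =ᵐ[P A] f)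
    (x : Seq2 A) : eLpNorm (pert g x) 2 (P A) = ENNReal.ofReal ‖f - U x‖ := by
  rw [eLpNorm_congr_ae (pert_congr h x), ← Lp.enorm_def, ofReal_norm]

/-! ### Riesz products -/

/-- The Walsh coefficients of the Riesz product `∏ (1 + 𝔦 s y(α) r_α)`. -/
def rieszCoeff {A : Type u} (y : Seq2 A) (s : ℝ) (F : Finset A) : ℂ :=
  ∏ α ∈ F, (Complex.I * s * y α)

theorem norm_rieszCoeff_sq {A : Type u} (y : Seq2 A) (s : ℝ) (F : Finset A) :
    ‖rieszCoeff y s F‖ ^ 2 = (s ^ 2) ^ F.card * ∏ α ∈ F, ‖y α‖ ^ 2 := by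
  rw [rieszCoeff, norm_prod, ← Finset.prod_pow, ← Finset.prod_const, ← Finset.prod_mul_distrib]
  refine Finset.prod_congr rfl fun α _ => ?_
  simp [mul_pow]

theorem hasSum_norm_sq {A : Type u} (y : Seq2 A) : HasSum (fun α => ‖y α‖ ^ 2) (‖y‖ ^ 2) := by
  have h := lp.hasSum_norm (p := 2) (by norm_num) y
  simpa using h

/-- All members of `T` are subsets of one finite set, and the sum over its subsets factors as `∏ (1
+ ‖y α‖²) ≤ exp (‖y‖²) ≤ e < 3`. The constant controls both the `L²` and the `L^∞` norms of Riesz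
products. -/
theorem sum_prod_norm_sq_le {A : Type u} {y : Seq2 A} (hy : ‖y‖ ≤ 1) (T : Finset (Finset A)) :
    ∑ F ∈ T, ∏ α ∈ F, ‖y α‖ ^ 2 ≤ 3 := by
  classical
  have h1 : T ⊆ (T.sup id).powerset := fun F hF =>
    Finset.mem_powerset.2 (Finset.le_sup (f := id) hF)
  calc ∑ F ∈ T, ∏ α ∈ F, ‖y α‖ ^ 2
      ≤ ∑ F ∈ (T.sup id).powerset, ∏ α ∈ F, ‖y α‖ ^ 2 :=
        Finset.sum_le_sum_of_subset_of_nonneg h1 fun F _ _ =>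
          Finset.prod_nonneg fun α _ => by positivity
    _ = ∏ α ∈ T.sup id, (1 + ‖y α‖ ^ 2) := (Finset.prod_one_add _).symm
    _ ≤ Real.exp (∑ α ∈ T.sup id, ‖y α‖ ^ 2) :=
        Real.prod_one_add_le_exp_sum _ fun α => by positivity
    _ ≤ Real.exp 1 := by
        refine Real.exp_le_exp.2 ?_
        have h2 := sum_le_hasSum (T.sup id) (fun α _ => by positivity) (hasSum_norm_sq y)
        nlinarith [norm_nonneg y]
    _ ≤ 3 := by linarith [Real.exp_one_lt_d9]

theorem summable_prod_norm_sq {A : Type u} {y : Seq2 A} (hy : ‖y‖ ≤ 1) :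
    Summable fun F : Finset A => ∏ α ∈ F, ‖y α‖ ^ 2 :=
  summable_of_sum_le (fun F => Finset.prod_nonneg fun α _ => by positivity)
    (sum_prod_norm_sq_le hy)

theorem memℓp_rieszCoeff {A : Type u} {y : Seq2 A} (hy : ‖y‖ ≤ 1) {s : ℝ} (hs0 : 0 < s)
    (hs1 : s ≤ 1) : Memℓp (rieszCoeff y s) 2 := by
  refine memℓp_gen ?_
  refine Summable.of_nonneg_of_le (fun F => by positivity) (fun F => ?_)
    (summable_prod_norm_sq hy)
  have h := norm_rieszCoeff_sq y s F
  have h1 : (s ^ 2) ^ F.card ≤ 1 := pow_le_one₀ (by positivity) (pow_le_one₀ hs0.le hs1)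
  have h2 : 0 ≤ ∏ α ∈ F, ‖y α‖ ^ 2 := Finset.prod_nonneg fun α _ => by positivity
  simp only [ENNReal.toReal_ofNat, Real.rpow_ofNat]
  rw [h]
  exact mul_le_of_le_one_left h2 h1

/-- Reality of `y` is essential: each factor then has squared modulus `1 + s² y(α)²`, with no linear
term. For imaginary `y` the factors would be `1 ± s‖y α‖`, whose products are not bounded on the
`l²` ball. -/
theorem norm_riesz_partial_le {A : Type u} {y : Seq2 A} (hy : ‖y‖ ≤ 1)
    (hre : ∀ α, (y α).im = 0) {s : ℝ} (hs0 : 0 < s) (hs1 : s ≤ 1) (S : Finset A) (ω : Omega A) :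
    ‖∑ F ∈ S.powerset, rieszCoeff y s F * walsh F ω‖ ≤ 2 := by
  classical
  have h1 : ∑ F ∈ S.powerset, rieszCoeff y s F * walsh F ω =
      ∏ α ∈ S, (1 + Complex.I * s * y α * rad α ω) := by
    rw [Finset.prod_one_add]
    refine Finset.sum_congr rfl fun F _ => ?_
    rw [rieszCoeff, walsh, ← Finset.prod_mul_distrib]
  have h2 : ∀ α, ‖1 + Complex.I * s * y α * rad α ω‖ ^ 2 ≤ 1 + ‖y α‖ ^ 2 := by
    intro α
    have hy' : y α = ((y α).re : ℂ) := Complex.ext rfl (by simp [hre])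
    rw [hy', rad, Complex.sq_norm, Complex.normSq_apply, Complex.norm_real]
    have hr : ((ω α : ℤ) : ℝ) ^ 2 = 1 := by
      rcases Int.units_eq_one_or (ω α) with h | h <;> simp [h]
    simp only [Complex.add_re, Complex.one_re, Complex.mul_re, Complex.I_re, Complex.ofReal_re,
      Complex.I_im, Complex.ofReal_im, Complex.mul_im, Complex.intCast_re, Complex.intCast_im,
      Complex.add_im, Complex.one_im, Real.norm_eq_abs, sq_abs]
    have h3 : s ^ 2 ≤ 1 := pow_le_one₀ hs0.le hs1
    have h4 : 0 ≤ (y α).re ^ 2 := sq_nonneg _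
    have h5 : (s * (y α).re * ((ω α : ℤ) : ℝ)) ^ 2 ≤ (y α).re ^ 2 := by
      rw [mul_pow, mul_pow, hr]; nlinarith
    nlinarith
  have h3 : ‖∏ α ∈ S, (1 + Complex.I * s * y α * rad α ω)‖ ^ 2 ≤ 3 := by
    rw [norm_prod, ← Finset.prod_pow]
    refine (Finset.prod_le_prod (fun _ _ => by positivity) fun α _ => h2 α).trans ?_
    rw [Finset.prod_one_add]
    exact sum_prod_norm_sq_le hy _
  rw [h1]
  nlinarith [norm_nonneg (∏ α ∈ S, (1 + Complex.I * s * y α * rad α ω))]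

theorem coeFn_sum_walsh2 {A : Type u} (c : Finset A → ℂ) (T : Finset (Finset A)) :
    (∑ F ∈ T, c F • walsh2 F : Lp ℂ 2 (P A)) =ᵐ[P A] fun ω => ∑ F ∈ T, c F * walsh F ω := by
  classical
  induction T using Finset.induction_on with
  | empty => simp only [Finset.sum_empty]; exact Lp.coeFn_zero ℂ 2 (P A)
  | insert F T hF ih =>
    rw [Finset.sum_insert hF]
    filter_upwards [ih, Lp.coeFn_add (c F • walsh2 F) (∑ F ∈ T, c F • walsh2 F),
      Lp.coeFn_smul (c F) (walsh2 F), (memLp_walsh F 2).coeFn_toLp] with ω h1 h2 h3 h4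
    rw [h2, Pi.add_apply, h1, h3, Pi.smul_apply, Finset.sum_insert hF]
    congr 1
    rw [walsh2, h4, smul_eq_mul]

theorem hasSum_walsh2_of_memℓp {A : Type u} {c : Finset A → ℂ} (hc : Memℓp c 2) :
    ∃ h : Lp ℂ 2 (P A), HasSum (fun F => c F • walsh2 F) h ∧ ∀ F, fourier h F = c F := by
  classical
  have hs := (orthonormal_walsh2 A).orthogonalFamily.summable_of_lp (⟨c, hc⟩ : lp _ 2)
  refine ⟨_, hs.hasSum, fun F => ?_⟩
  have h := hs.hasSum.mapL (innerSL ℂ (walsh2 F))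
  rw [innerSL_apply_apply, inner_walsh2_Lp] at h
  refine h.unique ?_
  have h2 : (fun E => innerSL ℂ (walsh2 F) (c E • walsh2 E)) =
      fun E => if E = F then c F else 0 := by
    funext E
    rw [innerSL_apply_apply, inner_smul_right, inner_walsh2_Lp, fourier_walsh2]
    split_ifs with hb <;> simp [hb]
  exact h2 ▸ hasSum_ite_eq F (c F)

theorem fourier_Lp_sub {A : Type u} (f g : Lp ℂ 2 (P A)) (F : Finset A) :
    fourier (f - g : Lp ℂ 2 (P A)) F = fourier f F - fourier g F := by
  rw [← inner_walsh2_Lp, inner_sub_right, inner_walsh2_Lp, inner_walsh2_Lp]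

theorem fourier_Lp_smul {A : Type u} (c : ℂ) (f : Lp ℂ 2 (P A)) (F : Finset A) :
    fourier (c • f : Lp ℂ 2 (P A)) F = c * fourier f F := by
  rw [← inner_walsh2_Lp, inner_smul_right, inner_walsh2_Lp]

/-- Bounded interpolation of real vectors in the unit ball, with perturbation at most `2 s`. -/
theorem exists_interpolant_of_real {A : Type u} {y : Seq2 A} (hy : ‖y‖ ≤ 1)
    (hre : ∀ α, (y α).im = 0) {s : ℝ} (hs0 : 0 < s) (hs1 : s ≤ 1) :
    ∃ g : Lp ℂ 2 (P A), g ∈ boundedSet (3 / s) ∧ (∀ α, fourier g {α} = y α) ∧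
      ‖g - U y‖ ≤ 2 * s := by
  classical
  obtain ⟨h, hsum, hcoeff⟩ := hasSum_walsh2_of_memℓp (memℓp_rieszCoeff hy hs0 hs1)
  have hIs : Complex.I * s ≠ 0 := by simp [hs0.ne']
  -- The Walsh series may be summed along powersets of growing finite sets; those partial sums are
  -- finite Riesz products.
  have hbdd : h ∈ boundedSet 2 := by
    refine (isClosed_boundedSet 2).mem_of_tendsto
      (hsum.comp tendsto_finset_powerset_atTop_atTop) (Eventually.of_forall fun S => ?_)
    filter_upwards [coeFn_sum_walsh2 (rieszCoeff y s) S.powerset] with ω hω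
    rw [Function.comp_apply, hω]
    exact norm_riesz_partial_le hy hre hs0 hs1 S ω
  have hg : ∀ F, fourier ((Complex.I * s)⁻¹ • (h - walsh2 ∅) : Lp ℂ 2 (P A)) F =
      (Complex.I * s)⁻¹ * (rieszCoeff y s F - if ∅ = F then 1 else 0) := by
    intro F
    rw [fourier_Lp_smul, fourier_Lp_sub, hcoeff, fourier_walsh2]
  -- Removing the constant term `1` costs one in the bound, `2 + 1 = 3`; dividing by `𝔦 s`
  -- normalises the first-order coefficients.
  refine ⟨(Complex.I * s)⁻¹ • (h - walsh2 ∅), ?_, ?_, ?_⟩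
  · filter_upwards [hbdd, Lp.coeFn_smul (Complex.I * s)⁻¹ (h - walsh2 ∅),
      Lp.coeFn_sub h (walsh2 ∅), (memLp_walsh (∅ : Finset A) 2).coeFn_toLp] with ω h1 h2 h3 h4
    rw [h2, Pi.smul_apply, h3, Pi.sub_apply, walsh2, h4, walsh_empty, norm_smul]
    have : ‖(Complex.I * s)⁻¹‖ = s⁻¹ := by simp [abs_of_pos hs0]
    rw [this, div_eq_inv_mul]
    have h5 : ‖h ω - 1‖ ≤ 3 := (norm_sub_le _ _).trans (by rw [norm_one]; linarith)
    gcongr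
  · intro α
    rw [hg]
    simp only [rieszCoeff, Finset.prod_singleton]
    rw [if_neg (Finset.singleton_ne_empty α).symm, sub_zero, ← mul_assoc, inv_mul_cancel₀ hIs,
      one_mul]
  · have hp := hasSum_norm_fourier_sq ((Complex.I * s)⁻¹ • (h - walsh2 ∅) - U y)
    -- Orders zero and one cancel exactly; at order `k + 2` the power of `s` is `s⁻² s^{2k+4} ≤ s²`.
    have hle : ∀ F, ‖fourier ((Complex.I * s)⁻¹ • (h - walsh2 ∅) - U y : Lp ℂ 2 (P A)) F‖ ^ 2 ≤
        s ^ 2 * ∏ α ∈ F, ‖y α‖ ^ 2 := by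
      intro F
      have hnn : 0 ≤ s ^ 2 * ∏ α ∈ F, ‖y α‖ ^ 2 :=
        mul_nonneg (sq_nonneg s) (Finset.prod_nonneg fun α _ => by positivity)
      rw [fourier_Lp_sub, hg]
      rcases Nat.lt_trichotomy F.card 1 with hF | hF | hF
      · obtain rfl : F = ∅ := Finset.card_eq_zero.1 (by omega)
        rw [fourier_U_of_card_ne _ (by simp)]
        simpa [rieszCoeff] using sq_nonneg s
      · obtain ⟨α, rfl⟩ := Finset.card_eq_one.1 hF
        rw [fourier_U_singleton]
        simp only [rieszCoeff, Finset.prod_singleton]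
        rw [if_neg (Finset.singleton_ne_empty α).symm, sub_zero, ← mul_assoc,
          inv_mul_cancel₀ hIs, one_mul, sub_self]
        simpa using hnn
      · have hne : ∅ ≠ F := by rintro rfl; simp at hF
        rw [fourier_U_of_card_ne _ (by omega), if_neg hne, sub_zero, sub_zero, norm_mul, mul_pow,
          norm_rieszCoeff_sq, ← mul_assoc]
        have h6 : ‖(Complex.I * s)⁻¹‖ = s⁻¹ := by simp [abs_of_pos hs0]
        rw [h6]
        have h7 : 0 ≤ ∏ α ∈ F, ‖y α‖ ^ 2 := Finset.prod_nonneg fun α _ => by positivity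
        refine mul_le_mul_of_nonneg_right ?_ h7
        obtain ⟨k, hk⟩ : ∃ k, F.card = k + 2 := ⟨F.card - 2, by omega⟩
        have h8 : (s ^ 2) ^ k ≤ 1 := pow_le_one₀ (by positivity) (pow_le_one₀ hs0.le hs1)
        have h9 : s⁻¹ ^ 2 * (s ^ 2) ^ F.card = s ^ 2 * (s ^ 2) ^ k := by
          rw [hk, pow_add]; field_simp
        rw [h9]
        exact mul_le_of_le_one_right (sq_nonneg s) h8
    have hsq : ‖(Complex.I * s)⁻¹ • (h - walsh2 ∅) - U y‖ ^ 2 ≤ s ^ 2 * 3 := by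
      refine (hasSum_le hle hp ((summable_prod_norm_sq hy).hasSum.mul_left (s ^ 2))).trans ?_
      refine mul_le_mul_of_nonneg_left ?_ (sq_nonneg s)
      exact (summable_prod_norm_sq hy).tsum_le_of_sum_le (sum_prod_norm_sq_le hy)
    -- `3 s² ≤ (2 s)²`.
    refine le_of_sq_le_sq ?_ (by positivity)
    nlinarith [sq_nonneg s]

/-! ### From real to complex vectors, and finiteness of `betaR` -/

theorem boundedSet_add {A : Type u} {C D : ℝ} {f g : Lp ℂ 2 (P A)} (hf : f ∈ boundedSet C)
    (hg : g ∈ boundedSet D) : f + g ∈ boundedSet (C + D) := by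
  filter_upwards [hf, hg, Lp.coeFn_add f g] with ω h1 h2 h3
  rw [h3, Pi.add_apply]
  exact (norm_add_le _ _).trans (add_le_add h1 h2)

theorem boundedSet_smul {A : Type u} {C : ℝ} {f : Lp ℂ 2 (P A)} (hf : f ∈ boundedSet C)
    (c : ℂ) : c • f ∈ boundedSet (‖c‖ * C) := by
  filter_upwards [hf, Lp.coeFn_smul c f] with ω h1 h3
  rw [h3, Pi.smul_apply, norm_smul]
  gcongr

theorem fourier_Lp_add {A : Type u} (f g : Lp ℂ 2 (P A)) (F : Finset A) :
    fourier (f + g : Lp ℂ 2 (P A)) F = fourier f F + fourier g F := by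
  rw [← inner_walsh2_Lp, inner_add_right, inner_walsh2_Lp, inner_walsh2_Lp]

/-- The real and imaginary parts `y`, `z` of `x` are interpolated separately, which doubles both
constants of the real case. -/
theorem exists_interpolant {A : Type u} {x : Seq2 A} (hx : ‖x‖ ≤ 1) {s : ℝ} (hs0 : 0 < s)
    (hs1 : s ≤ 1) :
    ∃ g : Lp ℂ 2 (P A), g ∈ boundedSet (6 / s) ∧ (∀ α, fourier g {α} = x α) ∧
      ‖g - U x‖ ≤ 4 * s := by
  set y : Seq2 A := (2⁻¹ : ℂ) • (x + star x) with hy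
  set z : Seq2 A := (-Complex.I * 2⁻¹ : ℂ) • (x - star x) with hz
  have hxyz : x = y + Complex.I • z := by
    rw [hy, hz, smul_smul, ← mul_assoc, mul_neg, Complex.I_mul_I, neg_neg, one_mul, ← smul_add,
      add_add_sub_cancel, ← two_smul ℂ, smul_smul]
    norm_num
  have hyn : ‖y‖ ≤ 1 := by
    rw [hy, norm_smul]
    have := norm_add_le x (star x)
    rw [norm_star] at this
    norm_num
    linarith
  have hzn : ‖z‖ ≤ 1 := by
    rw [hz, norm_smul]
    have := norm_sub_le x (star x)
    rw [norm_star] at this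
    norm_num
    linarith
  have hyr : ∀ α, (y α).im = 0 := fun α => by
    rw [hy, seq2_smul_apply, seq2_add_apply, seq2_star_apply]; simp
  have hzr : ∀ α, (z α).im = 0 := fun α => by
    rw [hz, seq2_smul_apply, seq2_sub_apply, seq2_star_apply]; simp
  obtain ⟨g, hg1, hg2, hg3⟩ := exists_interpolant_of_real hyn hyr hs0 hs1
  obtain ⟨h, hh1, hh2, hh3⟩ := exists_interpolant_of_real hzn hzr hs0 hs1
  refine ⟨g + Complex.I • h, ?_, fun α => ?_, ?_⟩
  · have := boundedSet_add hg1 (boundedSet_smul hh1 Complex.I)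
    rw [Complex.norm_I, one_mul, ← add_div] at this
    norm_num at this
    exact this
  · rw [fourier_Lp_add, fourier_Lp_smul, hg2, hh2, hxyz, seq2_add_apply, seq2_smul_apply Complex.I]
  · have : g + Complex.I • h - U x = (g - U y) + Complex.I • (h - U z) := by
      rw [hxyz, U_add, U_smul Complex.I, smul_sub]; abel
    rw [this]
    refine (norm_add_le _ _).trans ?_
    rw [norm_smul, Complex.norm_I, one_mul]
    linarith

theorem betaR_lt_top {δ : ℝ} (hδ0 : 0 < δ) (hδ1 : δ < 1) : betaR.{u} δ < ∞ := by
  have hC : 0 ≤ 6 / (δ / 4) := by positivity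
  refine lt_of_le_of_lt (b := ENNReal.ofReal (6 / (δ / 4))) ?_ ENNReal.ofReal_lt_top
  refine iSup_le fun A => iSup₂_le fun x hx => ?_
  have hx1 : ‖x‖ ≤ 1 := (mem_sphere_zero_iff_norm.1 hx).le
  -- With `s = δ / 4` the perturbation bound `4 s` is exactly `δ`, and the sup bound does not
  -- involve `A`.
  obtain ⟨f, hf1, hf2, hf3⟩ := exists_interpolant hx1 (s := δ / 4) (by linarith) (by linarith)
  obtain ⟨g, hgf, hg⟩ := exists_LInf_of_mem_boundedSet hC hf1
  refine (iInf₂_le g ⟨fun α => ?_, ?_⟩).trans ?_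
  · rw [← ofReal_norm]
    exact ENNReal.ofReal_le_ofReal hg
  · rw [fourier_congr hgf, hf2]
  · rw [eLpNorm_pert hgf]
    exact ENNReal.ofReal_le_ofReal (by linarith)

/-! ### Nested closed convex sets in a Hilbert space -/

/-- The points `p n` of minimal norm have increasing, bounded norms. For `n ≤ m` the midpoint of `p
n` and `p m` lies in `K n`, so the parallelogram law gives `‖p n - p m‖² ≤ 2 (‖p m‖² - ‖p n‖²)`.
Thus `p` is Cauchy and its limit lies in every `K n`. -/
theorem nonempty_iInter_of_convex {E : Type*} [NormedAddCommGroup E] [InnerProductSpace ℝ E]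
    [CompleteSpace E] {K : ℕ → Set E} (hanti : Antitone K) (hne : ∀ n, (K n).Nonempty)
    (hcl : ∀ n, IsClosed (K n)) (hconv : ∀ n, Convex ℝ (K n)) {R : ℝ}
    (hR : ∀ n, ∀ f ∈ K n, ‖f‖ ≤ R) : (⋂ n, K n).Nonempty := by
  have hmin : ∀ n, ∃ p ∈ K n, ∀ q ∈ K n, ‖p‖ ≤ ‖q‖ := by
    intro n
    obtain ⟨p, hp, hpi⟩ := exists_norm_eq_iInf_of_complete_convex (hne n) (hcl n).isComplete
      (hconv n) 0
    refine ⟨p, hp, fun q hq => ?_⟩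
    simp only [zero_sub, norm_neg] at hpi
    rw [hpi]
    exact ciInf_le (f := fun w : K n => ‖(w : E)‖)
      ⟨0, by rintro _ ⟨w, rfl⟩; exact norm_nonneg _⟩ ⟨q, hq⟩
  choose p hp hpm using hmin
  have hmono : Monotone fun n => ‖p n‖ ^ 2 := fun n m hnm =>
    pow_le_pow_left₀ (norm_nonneg _) (hpm n _ (hanti hnm (hp m))) 2
  have hbdd : BddAbove (Set.range fun n => ‖p n‖ ^ 2) :=
    ⟨R ^ 2, by rintro _ ⟨n, rfl⟩; exact pow_le_pow_left₀ (norm_nonneg _) (hR n _ (hp n)) 2⟩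
  set L := ⨆ n, ‖p n‖ ^ 2
  have hlim : Tendsto (fun n => ‖p n‖ ^ 2) atTop (𝓝 L) := tendsto_atTop_ciSup hmono hbdd
  have hle : ∀ n, ‖p n‖ ^ 2 ≤ L := fun n => le_ciSup hbdd n
  have hcauchy : CauchySeq p := by
    refine cauchySeq_of_le_tendsto_0' (fun n => √(2 * (L - ‖p n‖ ^ 2))) (fun n m hnm => ?_) ?_
    · rw [dist_eq_norm]
      refine Real.le_sqrt_of_sq_le ?_
      have hmid : (2⁻¹ : ℝ) • p n + (2⁻¹ : ℝ) • p m ∈ K n :=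
        hconv n (hp n) (hanti hnm (hp m)) (by norm_num) (by norm_num) (by norm_num)
      have h1 := hpm n _ hmid
      rw [← smul_add, norm_smul] at h1
      norm_num at h1
      have h2 := parallelogram_law_with_norm ℝ (p n) (p m)
      have h3 := hle m
      nlinarith [norm_nonneg (p n), norm_nonneg (p n + p m)]
    · have h := ((tendsto_const_nhds (x := L)).sub hlim).const_mul 2
      rw [sub_self, mul_zero] at h
      have h' := (Real.continuous_sqrt.tendsto 0).comp h
      rw [Real.sqrt_zero] at h'
      exact h'
  obtain ⟨f, hf⟩ := cauchySeq_tendsto_of_complete hcauchy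
  refine ⟨f, Set.mem_iInter.2 fun n => (hcl n).mem_of_tendsto hf ?_⟩
  filter_upwards [eventually_ge_atTop n] with m hm
  exact hanti hm (hp m)

/-! ### Attainment of the infimum in the definition of `β` -/

/-- The elements of `L²` bounded by `C` that interpolate `x` with perturbation at most `δ`. -/
def interpSet2 {A : Type u} (δ : ℝ) (x : Seq2 A) (C : ℝ) : Set (Lp ℂ 2 (P A)) :=
  {f | f ∈ boundedSet C ∧ (∀ α, fourier f {α} = x α) ∧ ‖f - U x‖ ≤ δ}

theorem isClosed_interpSet2 {A : Type u} (δ : ℝ) (x : Seq2 A) (C : ℝ) :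
    IsClosed (interpSet2 δ x C) := by
  refine (isClosed_boundedSet C).inter (IsClosed.inter ?_ ?_)
  · have h : {f : Lp ℂ 2 (P A) | ∀ α, fourier f {α} = x α} =
        ⋂ α, {f | innerSL ℂ (walsh2 {α}) f = x α} := by
      ext f
      simp [inner_walsh2_Lp]
    change IsClosed {f : Lp ℂ 2 (P A) | ∀ α, fourier f {α} = x α}
    rw [h]
    exact isClosed_iInter fun α => isClosed_eq (innerSL ℂ (walsh2 {α})).continuous continuous_const
  · change IsClosed {f : Lp ℂ 2 (P A) | ‖f - U x‖ ≤ δ}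
    exact isClosed_le (by fun_prop) continuous_const

theorem convex_interpSet2 {A : Type u} (δ : ℝ) (x : Seq2 A) (C : ℝ) :
    Convex ℝ (interpSet2 δ x C) := by
  rintro f ⟨hf1, hf2, hf3⟩ g ⟨hg1, hg2, hg3⟩ a b ha hb hab
  have hab' : (a : ℂ) + b = 1 := by exact_mod_cast hab
  have hsm : a • f + b • g = (a : ℂ) • f + (b : ℂ) • g := by
    simp only [Complex.coe_smul]
    rfl
  rw [hsm]
  refine ⟨?_, fun α => ?_, ?_⟩
  · have := boundedSet_add (boundedSet_smul hf1 (a : ℂ)) (boundedSet_smul hg1 (b : ℂ))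
    rwa [Complex.norm_of_nonneg ha, Complex.norm_of_nonneg hb, ← add_mul, hab, one_mul] at this
  · rw [fourier_Lp_add, fourier_Lp_smul, fourier_Lp_smul, hf2, hg2, ← add_mul, hab', one_mul]
  · have : (a : ℂ) • f + (b : ℂ) • g - U x = (a : ℂ) • (f - U x) + (b : ℂ) • (g - U x) := by
      calc _ = (a : ℂ) • f + (b : ℂ) • g - ((a : ℂ) + b) • U x := by rw [hab', one_smul]
        _ = _ := by rw [add_smul, smul_sub, smul_sub]; abel
    rw [this]
    refine (norm_add_le _ _).trans ?_
    rw [norm_smul, norm_smul, Complex.norm_of_nonneg ha, Complex.norm_of_nonneg hb]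
    calc a * ‖f - U x‖ + b * ‖g - U x‖ ≤ a * δ + b * δ := by gcongr
      _ = δ := by rw [← add_mul, hab, one_mul]

theorem interpSet2_mono {A : Type u} (δ : ℝ) (x : Seq2 A) : Monotone (interpSet2 δ x) := by
  rintro C D hCD f ⟨h1, h2⟩
  refine ⟨?_, h2⟩
  change ∀ᵐ ω ∂(P A), ‖f ω‖ ≤ D
  filter_upwards [h1] with ω hω
  exact hω.trans hCD

theorem interpSet2_nonempty_of_lt {A : Type u} {δ : ℝ} (hδ : 0 ≤ δ) {x : Seq2 A} (hx : ‖x‖ = 1)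
    (hβ : betaR.{u} δ < ∞) {C : ℝ} (hC : (betaR.{u} δ).toReal < C) :
    (interpSet2 δ x C).Nonempty := by
  have h1 : (⨅ g ∈ interpSet δ x, ‖g‖ₑ) ≤ betaR.{u} δ :=
    (le_iSup₂ (f := fun (x : Seq2 A) (_ : x ∈ Metric.sphere (0 : Seq2 A) 1) =>
      ⨅ g ∈ interpSet δ x, ‖g‖ₑ) x (mem_sphere_zero_iff_norm.2 hx)).trans
      (le_iSup (fun A : Type u => beta A δ) A)
  have h2 : betaR.{u} δ < ENNReal.ofReal C := by
    rw [← ENNReal.ofReal_toReal hβ.ne]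
    exact (ENNReal.ofReal_lt_ofReal_iff (ENNReal.toReal_nonneg.trans_lt hC)).2 hC
  obtain ⟨g, hg, hgC⟩ := by simpa only [iInf_lt_iff, exists_prop] using h1.trans_lt h2
  have hae := (memLp_two g).coeFn_toLp
  refine ⟨(memLp_two g).toLp _, ?_, fun α => ?_, ?_⟩
  · have hgC' : ‖g‖ ≤ C := by
      rw [← ofReal_norm] at hgC
      exact ((ENNReal.ofReal_lt_ofReal_iff_of_nonneg (norm_nonneg _)).1 hgC).le
    filter_upwards [hae, LInf_ae_norm_le g] with ω h3 h4
    rw [h3]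
    exact h4.trans hgC'
  · rw [fourier_congr hae, hg.1]
  · have := hg.2
    rw [eLpNorm_pert hae.symm, ENNReal.ofReal_le_ofReal_iff hδ] at this
    exact this

/-- The bound is attained, with no loss of `ε`: the sets with bounds `b + 1/(n+1)` are nested, and a
common point is bounded by `b`. -/
theorem interpSet2_nonempty {A : Type u} {δ : ℝ} (hδ : 0 ≤ δ) {x : Seq2 A} (hx : ‖x‖ = 1)
    (hβ : betaR.{u} δ < ∞) : (interpSet2 δ x (betaR.{u} δ).toReal).Nonempty := by
  set b := (betaR.{u} δ).toReal
  have hpos : ∀ n : ℕ, 0 < 1 / ((n : ℝ) + 1) := fun n => Nat.one_div_pos_of_nat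
  obtain ⟨f, hf⟩ := nonempty_iInter_of_convex
    (K := fun n : ℕ => interpSet2 δ x (b + 1 / ((n : ℝ) + 1))) (R := δ + ‖U x‖)
    (fun n m hnm => interpSet2_mono δ x (by gcongr))
    (fun n => interpSet2_nonempty_of_lt hδ hx hβ (by have := hpos n; linarith))
    (fun n => isClosed_interpSet2 _ _ _) (fun n => convex_interpSet2 _ _ _) (by
      rintro n f ⟨-, -, hf⟩
      calc ‖f‖ = ‖f - U x + U x‖ := by rw [sub_add_cancel]
        _ ≤ _ := (norm_add_le _ _).trans (by gcongr))
  rw [Set.mem_iInter] at hf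
  refine ⟨f, ?_, (hf 0).2⟩
  have hall : ∀ᵐ ω ∂(P A), ∀ n : ℕ, ‖f ω‖ ≤ b + 1 / ((n : ℝ) + 1) :=
    ae_all_iff.2 fun n => (hf n).1
  change ∀ᵐ ω ∂(P A), ‖f ω‖ ≤ b
  filter_upwards [hall] with ω hω
  have hlim := (tendsto_const_nhds (x := b)).add
    (tendsto_one_div_add_atTop_nhds_zero_nat (𝕜 := ℝ))
  rw [add_zero] at hlim
  exact ge_of_tendsto hlim (Eventually.of_forall hω)

/-! ### Odd parts -/

theorem integral_comp_measurePreserving {X Y : Type*} [MeasurableSpace X] [MeasurableSpace Y]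
    {μ : Measure X} {ν : Measure Y} {φ : X → Y} (hφ : MeasurePreserving φ μ ν) {f : Y → ℂ}
    (hf : AEStronglyMeasurable f ν) : ∫ x, f (φ x) ∂μ = ∫ y, f y ∂ν := by
  rw [← hφ.map_eq] at hf ⊢
  exact (integral_map hφ.measurable.aemeasurable hf).symm

theorem measurePreserving_neg {A : Type u} :
    MeasurePreserving (fun (ω : Omega A) a => -ω a) (P A) (P A) := by
  have hm : ∀ _ : A, Measurable (fun z : ℤˣ => -z) := fun _ => Measurable.of_discrete
  refine ⟨measurable_pi_lambda _ fun a => (hm a).comp (measurable_pi_apply a), ?_⟩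
  have h := Measure.infinitePi_map_pi (μ := fun _ : A => coin) (f := fun _ (z : ℤˣ) => -z) hm
  simp only [measurePreserving_neg_coin.map_eq] at h
  exact h

theorem walsh_neg {A : Type u} (F : Finset A) (ω : Omega A) :
    walsh F (fun a => -ω a) = (-1) ^ F.card * walsh F ω := by
  rw [walsh, walsh, ← Finset.prod_const, ← Finset.prod_mul_distrib]
  refine Finset.prod_congr rfl fun α _ => ?_
  simp [rad]

/-- The odd part `(f(ω) - f(-ω)) / 2`. -/
def oddPart {A : Type u} (f : Lp ℂ 2 (P A)) : Lp ℂ 2 (P A) :=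
  (2⁻¹ : ℂ) • (f - Lp.compMeasurePreserving _ measurePreserving_neg f)

theorem fourier_comp_neg {A : Type u} (f : Lp ℂ 2 (P A)) (F : Finset A) :
    fourier (Lp.compMeasurePreserving _ measurePreserving_neg f) F =
      (-1) ^ F.card * fourier f F := by
  rw [fourier_congr (Lp.coeFn_compMeasurePreserving f measurePreserving_neg), fourier_eq,
    fourier_eq]
  have h1 : ∫ ω, f ω * walsh F ω ∂(P A) =
      ∫ ω, f (fun a => -ω a) * walsh F (fun a => -ω a) ∂(P A) := by
    exact (integral_comp_measurePreserving measurePreserving_neg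
      (integrable_mul_walsh (integrable_Lp2 f) F).aestronglyMeasurable).symm
  rw [h1, ← integral_const_mul]
  refine integral_congr_ae (Eventually.of_forall fun ω => ?_)
  have h2 : ((-1 : ℂ) ^ F.card) * (-1) ^ F.card = 1 := by
    rw [← mul_pow]; simp
  simp only [walsh_neg, Function.comp_apply]
  linear_combination (-f (fun a => -ω a) * walsh F ω) * h2

theorem fourier_oddPart {A : Type u} (f : Lp ℂ 2 (P A)) (F : Finset A) :
    fourier (oddPart f) F = 2⁻¹ * (1 - (-1) ^ F.card) * fourier f F := by
  rw [oddPart, fourier_Lp_smul, fourier_Lp_sub, fourier_comp_neg]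
  ring

theorem oddPart_mem_boundedSet {A : Type u} {C : ℝ} {f : Lp ℂ 2 (P A)} (hf : f ∈ boundedSet C) :
    oddPart f ∈ boundedSet C := by
  have h1 : Lp.compMeasurePreserving _ measurePreserving_neg f ∈ boundedSet C := by
    filter_upwards [Lp.coeFn_compMeasurePreserving f measurePreserving_neg,
      measurePreserving_neg.quasiMeasurePreserving.ae hf] with ω h2 h3
    rw [h2]
    exact h3
  have h2 := boundedSet_smul (boundedSet_add hf (boundedSet_smul h1 (-1))) 2⁻¹
  rw [neg_one_smul, ← sub_eq_add_neg] at h2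
  have hC : ‖(2⁻¹ : ℂ)‖ * (C + ‖(-1 : ℂ)‖ * C) = C := by
    norm_num
    ring
  rw [hC] at h2
  exact h2

/-- The odd part keeps coefficients of odd order and erases those of even order, where `U x` has
none; so each coefficient of the perturbation is kept or set to zero. -/
theorem oddPart_mem_interpSet2 {A : Type u} {δ C : ℝ} {x : Seq2 A}
    {f : Lp ℂ 2 (P A)} (hf : f ∈ interpSet2 δ x C) : oddPart f ∈ interpSet2 δ x C := by
  obtain ⟨h1, h2, h3⟩ := hf
  refine ⟨oddPart_mem_boundedSet h1, fun α => ?_, ?_⟩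
  · rw [fourier_oddPart, h2, Finset.card_singleton]
    norm_num
  · have hle : ∀ F, ‖fourier (oddPart f - U x : Lp ℂ 2 (P A)) F‖ ^ 2 ≤
        ‖fourier (f - U x : Lp ℂ 2 (P A)) F‖ ^ 2 := by
      intro F
      rw [fourier_Lp_sub, fourier_Lp_sub, fourier_oddPart]
      rcases Nat.even_or_odd F.card with hF | hF
      · rw [fourier_U_of_card_ne _ (by rintro h; rw [h] at hF; exact absurd hF (by decide)),
          hF.neg_one_pow]
        simp
      · rw [hF.neg_one_pow]
        norm_num
    have := hasSum_le hle (hasSum_norm_fourier_sq (oddPart f - U x))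
      (hasSum_norm_fourier_sq (f - U x))
    exact (le_of_sq_le_sq this (norm_nonneg _)).trans h3

/-! ### Existence of admissible selections -/

theorem fourier_empty {A : Type u} (f : Omega A → ℂ) : fourier f ∅ = ∫ ω, f ω ∂(P A) := by
  simp [fourier_eq, walsh_empty]

theorem exists_extremal {A : Type u} {δ : ℝ} (hδ : 0 ≤ δ) {x : Seq2 A} (hx : ‖x‖ = 1)
    (hβ : betaR.{u} δ < ∞) :
    ∃ g ∈ interpSet δ x, ‖g‖ₑ ≤ betaR.{u} δ ∧ ∫ ω, g ω ∂(P A) = 0 := by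
  obtain ⟨f, hf⟩ := interpSet2_nonempty hδ hx hβ
  obtain ⟨h1, h2, h3⟩ := oddPart_mem_interpSet2 hf
  obtain ⟨g, hgf, hg⟩ := exists_LInf_of_mem_boundedSet ENNReal.toReal_nonneg h1
  refine ⟨g, ⟨fun α => ?_, ?_⟩, ?_, ?_⟩
  · rw [fourier_congr hgf, h2]
  · rw [eLpNorm_pert hgf]
    exact ENNReal.ofReal_le_ofReal h3
  · rw [← ofReal_norm]
    exact ENNReal.ofReal_le_of_le_toReal hg
  · rw [← fourier_empty, fourier_congr hgf, fourier_oddPart]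
    simp

/-! ### Radial extension from the unit sphere -/

theorem pert_smul {A : Type u} (c : ℂ) (g : LInf A) (x : Seq2 A) :
    pert (c • g) (c • x) =ᵐ[P A] fun ω => c * pert g x ω := by
  filter_upwards [Lp.coeFn_smul c g, Lp.coeFn_smul c (U x)] with ω h1 h2
  rw [pert, h1, U_smul, h2, pert, Pi.smul_apply, Pi.smul_apply, smul_eq_mul, smul_eq_mul, mul_sub]

theorem fourier_LInf_smul {A : Type u} (c : ℂ) (g : LInf A) (F : Finset A) :
    fourier (c • g : LInf A) F = c * fourier g F := by
  rw [fourier_congr (Lp.coeFn_smul c g), ← fourier_smul]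
  rfl

theorem norm_sigma {A : Type u} {x : Seq2 A} (hx : x ≠ 0) : ‖sigma x‖ = 1 := by
  have := norm_ne_zero_iff.2 hx
  rw [sigma, norm_smul, Complex.norm_real, norm_inv, norm_norm, inv_mul_cancel₀ this]

theorem norm_smul_sigma {A : Type u} {x : Seq2 A} (hx : x ≠ 0) : (‖x‖ : ℂ) • sigma x = x := by
  have : (‖x‖ : ℂ) ≠ 0 := by exact_mod_cast norm_ne_zero_iff.2 hx
  rw [sigma, smul_smul, Complex.ofReal_inv, mul_inv_cancel₀ this, one_smul]

theorem sigma_of_norm_eq_one {A : Type u} {x : Seq2 A} (hx : ‖x‖ = 1) : sigma x = x := by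
  rw [sigma, hx]; simp

theorem injective_of_fourier {A A' : Type u} {ι : A ↪ A'} {G : Seq2 A → LInf A'}
    (h : ∀ x α, fourier (G x) {ι α} = x α) : Function.Injective G := by
  intro x y hxy
  ext α
  rw [← h, ← h, hxy]

/-- The positively homogeneous extension of a map defined on the unit sphere. -/
def radial {B : Type u} (g : Seq2 B → LInf B) (x : Seq2 B) : LInf B :=
  (‖x‖ : ℂ) • g (sigma x)

theorem radial_zero {B : Type u} (g : Seq2 B → LInf B) : radial g 0 = 0 := by
  rw [radial, norm_zero, Complex.ofReal_zero, zero_smul]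

theorem enorm_ofReal_norm {E : Type*} [NormedAddCommGroup E] (x : E) : ‖(‖x‖ : ℂ)‖ₑ = ‖x‖ₑ := by
  rw [← ofReal_norm, ← ofReal_norm, Complex.norm_real, norm_norm]

theorem pert_radial {B : Type u} (g : Seq2 B → LInf B) {x : Seq2 B} (hx : x ≠ 0) :
    pert (radial g x) x =ᵐ[P B] (‖x‖ : ℂ) • pert (g (sigma x)) (sigma x) := by
  have h := pert_smul (‖x‖ : ℂ) (g (sigma x)) (sigma x)
  rw [norm_smul_sigma hx] at h
  exact h

theorem pert_zero (B : Type u) : pert (0 : LInf B) 0 =ᵐ[P B] 0 := by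
  have h := pert_smul 0 (0 : LInf B) (0 : Seq2 B)
  rw [zero_smul, zero_smul] at h
  filter_upwards [h] with ω hω
  rw [hω, zero_mul, Pi.zero_apply]

theorem fourier_LInf_zero {B : Type u} (F : Finset B) : fourier (0 : LInf B) F = 0 := by
  have h := fourier_LInf_smul 0 (0 : LInf B) F
  rwa [zero_smul, zero_mul] at h

theorem exists_interpolant_map (B : Type u) {δ : ℝ} (hδ : 0 ≤ δ) (hβ : betaR.{u} δ < ∞) :
    ∃ G : Seq2 B → LInf B, IsInterpolant (Function.Embedding.refl _) G ∧
      (∀ x, ‖G x‖ₑ ≤ betaR.{u} δ * ‖x‖ₑ) ∧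
      (∀ x, eLpNorm (pert (G x) x) 2 (P B) ≤ ENNReal.ofReal δ * ‖x‖ₑ) ∧
      ∀ x, ∫ ω, G x ω ∂(P B) = 0 := by
  have hex : ∀ x : Seq2 B, ∃ g : LInf B, ‖x‖ = 1 →
      g ∈ interpSet δ x ∧ ‖g‖ₑ ≤ betaR.{u} δ ∧ ∫ ω, g ω ∂(P B) = 0 := by
    intro x
    by_cases hx : ‖x‖ = 1
    · obtain ⟨g, h1, h2⟩ := exists_extremal hδ hx hβ
      exact ⟨g, fun _ => ⟨h1, h2⟩⟩
    -- A default value: `radial` evaluates `g` off the sphere only at `sigma 0 = 0`, with factor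
    -- zero.
    · exact ⟨0, fun h => absurd h hx⟩
  choose g hg using hex
  have hfour : ∀ x α, fourier (radial g x) {α} = x α := by
    intro x α
    rcases eq_or_ne x 0 with rfl | hx
    · rw [radial_zero, fourier_LInf_zero]; rfl
    · rw [radial, fourier_LInf_smul, ((hg _ (norm_sigma hx)).1).1, ← seq2_smul_apply,
        norm_smul_sigma hx]
  refine ⟨radial g, ⟨injective_of_fourier (ι := Function.Embedding.refl _) hfour, radial_zero g,
    ?_, hfour⟩, fun x => ?_, fun x => ?_, fun x => ?_⟩
  · intro x hx
    rw [radial, radial, norm_sigma hx, sigma_of_norm_eq_one (norm_sigma hx), Complex.ofReal_one,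
      one_smul]
  · rcases eq_or_ne x 0 with rfl | hx
    · rw [radial_zero, enorm_zero]; exact zero_le
    · rw [radial, enorm_smul, mul_comm, enorm_ofReal_norm]
      exact mul_le_mul_left (hg _ (norm_sigma hx)).2.1 _
  · rcases eq_or_ne x 0 with rfl | hx
    · rw [radial_zero, eLpNorm_congr_ae (pert_zero B), eLpNorm_zero]
      exact zero_le
    · rw [eLpNorm_congr_ae (pert_radial g hx), eLpNorm_const_smul, mul_comm, enorm_ofReal_norm]
      exact mul_le_mul_left (hg _ (norm_sigma hx)).1.2 _
  · rcases eq_or_ne x 0 with rfl | hx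
    · rw [← fourier_empty, radial_zero, fourier_LInf_zero]
    · rw [← fourier_empty, radial, fourier_LInf_smul, fourier_empty, (hg _ (norm_sigma hx)).2.2,
        mul_zero]

theorem exists_isSelection (A : Type u) {δ : ℝ} (hδ : 0 ≤ δ) (hβ : betaR.{u} δ < ∞) :
    ∃ G : ∀ j, Seq2 (cascade A j) → LInf (cascade A j), IsSelection A δ G := by
  choose G h1 h2 h3 h4 using fun j => exists_interpolant_map (cascade A j) hδ hβ
  exact ⟨G, h1, h2, h3, h4⟩

/-! ### The bilinear pairing on `L^∞` -/

theorem integrable_LInf_mul {A : Type u} (f g : LInf A) :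
    Integrable (fun ω => f ω * g ω) (P A) :=
  (integrable_LInf f).mul_bdd (c := ‖g‖) (Lp.aestronglyMeasurable g) (LInf_ae_norm_le g)

theorem norm_integral_mul_le {A : Type u} (f g : LInf A) :
    ‖∫ ω, f ω * g ω ∂(P A)‖ ≤ ‖f‖ * ‖g‖ := by
  refine (norm_integral_le_of_norm_le_const (C := ‖f‖ * ‖g‖) ?_).trans (by simp)
  filter_upwards [LInf_ae_norm_le f, LInf_ae_norm_le g] with ω h1 h2
  rw [norm_mul]
  gcongr

/-- The bounded bilinear form `(f, g) ↦ ∫ f g` on `L^∞(Ω_A, ℙ_A)`. -/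
def pairing (A : Type u) : LInf A →L[ℂ] LInf A →L[ℂ] ℂ :=
  LinearMap.mkContinuous₂
    (LinearMap.mk₂ ℂ (fun f g : LInf A => ∫ ω, f ω * g ω ∂(P A))
      (fun f f' g => by
        rw [← integral_add (integrable_LInf_mul f g) (integrable_LInf_mul f' g)]
        refine integral_congr_ae ?_
        filter_upwards [Lp.coeFn_add f f'] with ω h
        rw [h, Pi.add_apply, add_mul])
      (fun c f g => by
        rw [smul_eq_mul, ← integral_const_mul]
        refine integral_congr_ae ?_
        filter_upwards [Lp.coeFn_smul c f] with ω h
        rw [h, Pi.smul_apply, smul_eq_mul, mul_assoc])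
      (fun f g g' => by
        rw [← integral_add (integrable_LInf_mul f g) (integrable_LInf_mul f g')]
        refine integral_congr_ae ?_
        filter_upwards [Lp.coeFn_add g g'] with ω h
        rw [h, Pi.add_apply, mul_add])
      (fun c f g => by
        rw [smul_eq_mul, ← integral_const_mul]
        refine integral_congr_ae ?_
        filter_upwards [Lp.coeFn_smul c g] with ω h
        rw [h, Pi.smul_apply, smul_eq_mul, mul_left_comm]))
    1 (fun f g => by
      rw [one_mul]
      exact norm_integral_mul_le f g)

theorem pairing_apply {A : Type u} (f g : LInf A) :
    pairing A f g = ∫ ω, f ω * g ω ∂(P A) := rfl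

/-- A Walsh character as an element of `L^∞(Ω_A, ℙ_A)`. -/
def walshInf {A : Type u} (F : Finset A) : LInf A := (memLp_walsh F ∞).toLp _

/-- Walsh coefficients are thereby continuous functionals on `L^∞` and can be taken term by term in
the series. -/
theorem pairing_walshInf {A : Type u} (f : LInf A) (F : Finset A) :
    pairing A f (walshInf F) = fourier f F := by
  rw [pairing_apply, fourier_eq]
  refine integral_congr_ae ?_
  filter_upwards [(memLp_walsh F ∞).coeFn_toLp] with ω h
  rw [walshInf, h]

/-! ### Functions lifted from a subset of the coordinates -/

theorem coeFn_lift {B A' : Type u} (ι : B ↪ A') (g : LInf B) :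
    lift ι g =ᵐ[P A'] g ∘ proj ι :=
  Lp.coeFn_compMeasurePreserving g (measurePreserving_proj ι)

theorem norm_lift {B A' : Type u} (ι : B ↪ A') (g : LInf B) : ‖lift ι g‖ = ‖g‖ :=
  Lp.norm_compMeasurePreserving g (measurePreserving_proj ι)

theorem lift_smul {B A' : Type u} (ι : B ↪ A') (c : ℂ) (g : LInf B) :
    lift ι (c • g) = c • lift ι g :=
  (Lp.compMeasurePreservingₗ ℂ (proj ι) (measurePreserving_proj ι)).map_smul c g

theorem fourier_lift_map {B A' : Type u} (ι : B ↪ A') (g : LInf B) (F : Finset B) :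
    fourier (lift ι g) (F.map ι) = fourier g F := by
  rw [fourier_congr (coeFn_lift ι g), fourier_eq, fourier_eq,
    ← integral_comp_measurePreserving (measurePreserving_proj ι)
      (integrable_mul_walsh (integrable_LInf g) F).aestronglyMeasurable]
  refine integral_congr_ae (Eventually.of_forall fun ω => ?_)
  simp only [Function.comp_apply, walsh, Finset.prod_map]
  rfl

theorem fourier_lift_singleton {B A' : Type u} (ι : B ↪ A') (g : LInf B) (b : B) :
    fourier (lift ι g) {ι b} = fourier g {b} := by
  rw [← fourier_lift_map ι g {b}, Finset.map_singleton]

/-- Flipping the coordinate `a` preserves the measure and the lifted function but changes the sign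
of `walsh F`. -/
theorem fourier_lift_of_notMem_range {B A' : Type u} (ι : B ↪ A') (g : LInf B) {F : Finset A'}
    {a : A'} (ha : a ∈ F) (har : a ∉ Set.range ι) : fourier (lift ι g) F = 0 := by
  classical
  have hm : AEStronglyMeasurable (fun ω => (g ∘ proj ι) ω * walsh F ω) (P A') :=
    ((Lp.aestronglyMeasurable g).comp_measurePreserving (measurePreserving_proj ι)).mul
      (measurable_walsh F).aestronglyMeasurable
  have h := integral_comp_measurePreserving (measurePreserving_flipCoord a) hm
  have hp : ∀ ω, proj ι (flipCoord a ω) = proj ι ω := by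
    intro ω
    funext b
    have : ι b ≠ a := fun hb => har ⟨b, hb⟩
    simp [proj, flipCoord, this]
  simp only [Function.comp_apply, hp, walsh_flip, ha, if_true, neg_mul, one_mul, mul_neg,
    integral_neg] at h
  rw [fourier_congr (coeFn_lift ι g), fourier_eq]
  exact self_eq_neg.1 h.symm

theorem integral_lift_mul_lift {B A' : Type u} (ι : B ↪ A') (f g : LInf B) :
    ∫ ω, lift ι f ω * lift ι g ω ∂(P A') = ∫ ω, f ω * g ω ∂(P B) := by
  rw [← integral_comp_measurePreserving (measurePreserving_proj ι)
    (integrable_LInf_mul f g).aestronglyMeasurable]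
  refine integral_congr_ae ?_
  filter_upwards [coeFn_lift ι f, coeFn_lift ι g] with ω h1 h2
  rw [h1, h2]
  rfl

/-- Mean-zero functions of disjoint sets of coordinates are orthogonal. -/
theorem integral_lift_mul_lift_of_disjoint {B C A' : Type u} (ι : B ↪ A') (κ : C ↪ A')
    (hd : Disjoint (Set.range ι) (Set.range κ)) (f : LInf B) (g : LInf C)
    (hf : ∫ ω, f ω ∂(P B) = 0) : ∫ ω, lift ι f ω * lift κ g ω ∂(P A') = 0 := by
  refine (hasSum_fourier_mul (memLp_two _) (memLp_two _)).unique ?_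
  have h : (fun F => fourier (lift ι f) F * fourier (lift κ g) F) = fun _ => 0 := by
    funext F
    -- At `∅` the mean of `f` vanishes; otherwise any `a ∈ F` misses one of the two ranges.
    rcases F.eq_empty_or_nonempty with rfl | ⟨a, ha⟩
    · have h0 := fourier_lift_map ι f ∅
      rw [Finset.map_empty, fourier_empty f, hf] at h0
      rw [h0, zero_mul]
    · by_cases har : a ∈ Set.range ι
      · rw [fourier_lift_of_notMem_range κ g ha (Set.disjoint_left.1 hd har), mul_zero]
      · rw [fourier_lift_of_notMem_range ι f ha har, zero_mul]
  rw [h]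
  exact hasSum_zero

/-! ### One step of the cascade -/

/-- The dot product `∑ x(α) y(α)`. -/
def dot {B : Type u} (x y : Seq2 B) : ℂ := inner ℂ (star x) y

theorem hasSum_dot {B : Type u} (x y : Seq2 B) : HasSum (fun α => x α * y α) (dot x y) := by
  have h := lp.hasSum_inner (𝕜 := ℂ) (star x) y
  have h2 : (fun α => inner ℂ ((star x) α) (y α)) = fun α => x α * y α := by
    funext α
    rw [seq2_star_apply, RCLike.inner_apply, Complex.conj_conj, mul_comm]
  rw [h2] at h
  exact h

theorem norm_dot_le {B : Type u} (x y : Seq2 B) : ‖dot x y‖ ≤ ‖x‖ * ‖y‖ := by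
  have h := norm_inner_le_norm (𝕜 := ℂ) (star x) y
  rwa [norm_star] at h

/-- The Parseval formula for mean-zero bounded interpolants. -/
theorem integral_mul_eq_dot_add_dot {B : Type u} {g h : LInf B} {x y : Seq2 B}
    (hg : ∀ α, fourier g {α} = x α) (hh : ∀ α, fourier h {α} = y α)
    (hg0 : ∫ ω, g ω ∂(P B) = 0) :
    ∫ ω, g ω * h ω ∂(P B) = dot x y + dot (nextVec g x) (nextVec h y) := by
  refine (hasSum_fourier_mul (memLp_two g) (memLp_two h)).unique ?_
  -- Parseval's sum is split by order: one gives `dot x y`, two or more gives the next vectors, and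
  -- zero is killed by the mean.
  have h1 : HasSum (fun F : Finset B => if F.card = 1 then fourier g F * fourier h F else 0)
      (dot x y) := by
    rw [← (Finset.singleton_injective (α := B)).hasSum_iff]
    · have : ((fun F : Finset B => if F.card = 1 then fourier g F * fourier h F else 0) ∘
          singleton) = fun α => x α * y α := by
        funext α
        simp [hg, hh]
      rw [this]
      exact hasSum_dot x y
    · intro F hF
      refine if_neg fun hc => hF ?_
      obtain ⟨α, rfl⟩ := Finset.card_eq_one.1 hc
      exact ⟨α, rfl⟩
  have h2 : HasSum (fun F : Finset B => if 2 ≤ F.card then fourier g F * fourier h F else 0)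
      (dot (nextVec g x) (nextVec h y)) := by
    rw [← (Subtype.val_injective (p := fun F : Finset B => 2 ≤ F.card)).hasSum_iff]
    · have : ((fun F : Finset B => if 2 ≤ F.card then fourier g F * fourier h F else 0) ∘
          Subtype.val) = fun F : Next B => nextVec g x F * nextVec h y F := by
        funext F
        rw [nextVec_apply, nextVec_apply, Function.comp_apply, if_pos F.2]
      rw [this]
      exact hasSum_dot _ _
    · intro F hF
      exact if_neg fun hc => hF ⟨⟨F, hc⟩, rfl⟩
  have h3 : (fun F => fourier g F * fourier h F) = fun F : Finset B =>
      (if F.card = 1 then fourier g F * fourier h F else 0) +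
        (if 2 ≤ F.card then fourier g F * fourier h F else 0) := by
    funext F
    rcases Nat.lt_trichotomy F.card 1 with hF | hF | hF
    · obtain rfl : F = ∅ := Finset.card_eq_zero.1 (by omega)
      rw [fourier_empty g, hg0]
      simp
    · rw [if_pos hF, if_neg (by omega), add_zero]
    · rw [if_neg (by omega), if_pos (by omega), zero_add]
  rw [h3]
  exact h1.add h2

/-- Bessel's inequality: `nextVec g x` lists only some of the coefficients of the perturbation. -/
theorem norm_nextVec_le {B : Type u} (g : LInf B) (x : Seq2 B) :
    ‖nextVec g x‖ ≤ (eLpNorm (pert g x) 2 (P B)).toReal := by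
  rw [← Lp.norm_toLp _ (memLp_pert g x)]
  refine le_of_sq_le_sq ?_ (norm_nonneg _)
  refine hasSum_le_inj (Subtype.val : Next B → Finset B) Subtype.val_injective
    (fun _ _ => sq_nonneg _) (fun F => ?_) (hasSum_norm_sq (nextVec g x))
    (hasSum_norm_fourier_sq ((memLp_pert g x).toLp _))
  rw [fourier_congr (memLp_pert g x).coeFn_toLp]
  rfl

/-! ### The cascade series of an admissible selection -/

variable {A : Type u} {δ : ℝ} {G : ∀ j, Seq2 (cascade A j) → LInf (cascade A j)}

theorem norm_vec_le (hG : IsSelection A δ G) (hδ : 0 ≤ δ) (x : Seq2 A) (j : ℕ) :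
    ‖vec G x j‖ ≤ δ ^ j * ‖x‖ := by
  induction j with
  | zero => rw [pow_zero, one_mul]; rfl
  | succ j ih =>
    have h1 : ‖nextVec (G j (vec G x j)) (vec G x j)‖ ≤ δ * ‖vec G x j‖ := by
      refine (norm_nextVec_le _ _).trans (ENNReal.toReal_le_of_le_ofReal (by positivity) ?_)
      refine (hG.pert_le j _).trans_eq ?_
      rw [ENNReal.ofReal_mul hδ, ofReal_norm]
    refine h1.trans ?_
    rw [pow_succ', mul_assoc]
    gcongr

/-- Powers of `𝔦` and lifts preserve norms, so the decay of the vector-cascade passes to the terms.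
-/
theorem norm_seriesTerm_le (hG : IsSelection A δ G) (hδ : 0 ≤ δ) (hβ : betaR.{u} δ < ∞)
    (x : Seq2 A) (j : ℕ) :
    ‖seriesTerm G j x‖ ≤ (betaR.{u} δ).toReal * ‖x‖ * δ ^ j := by
  have h1 : ‖G j (vec G x j)‖ ≤ (betaR.{u} δ).toReal * ‖vec G x j‖ := by
    have h := hG.norm_le j (vec G x j)
    rwa [← ENNReal.ofReal_toReal hβ.ne, ← ofReal_norm, ← ofReal_norm,
      ← ENNReal.ofReal_mul ENNReal.toReal_nonneg,
      ENNReal.ofReal_le_ofReal_iff (mul_nonneg ENNReal.toReal_nonneg (norm_nonneg _))] at h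
  rw [seriesTerm, norm_smul, norm_pow, Complex.norm_I, one_pow, one_mul, norm_lift]
  refine h1.trans ?_
  rw [mul_assoc, mul_comm ‖x‖]
  exact mul_le_mul_of_nonneg_left (norm_vec_le hG hδ x j) ENNReal.toReal_nonneg

theorem summable_norm_seriesTerm (hG : IsSelection A δ G) (hδ0 : 0 ≤ δ) (hδ1 : δ < 1)
    (hβ : betaR.{u} δ < ∞) (x : Seq2 A) : Summable fun j => ‖seriesTerm G j x‖ :=
  Summable.of_nonneg_of_le (fun _ => norm_nonneg _) (norm_seriesTerm_le hG hδ0 hβ x)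
    ((summable_geometric_of_lt_one hδ0 hδ1).mul_left _)

theorem hasSum_seriesTerm (hG : IsSelection A δ G) (hδ0 : 0 ≤ δ) (hδ1 : δ < 1)
    (hβ : betaR.{u} δ < ∞) (x : Seq2 A) : HasSum (fun j => seriesTerm G j x) (Phi G x) :=
  (summable_norm_seriesTerm hG hδ0 hδ1 hβ x).of_norm.hasSum

theorem norm_Phi_le (hG : IsSelection A δ G) (hδ0 : 0 ≤ δ) (hδ1 : δ < 1)
    (hβ : betaR.{u} δ < ∞) (x : Seq2 A) :
    ‖Phi G x‖ ≤ (betaR.{u} δ).toReal * ‖x‖ * (1 - δ)⁻¹ :=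
  tsum_of_norm_bounded ((hasSum_geometric_of_lt_one hδ0 hδ1).mul_left _)
    (norm_seriesTerm_le hG hδ0 hβ x)

theorem supNorm_Phi_le (hG : IsSelection A δ G) (hδ0 : 0 ≤ δ) (hδ1 : δ < 1)
    (hβ : betaR.{u} δ < ∞) : supNorm (Phi G) ≤ betaR.{u} δ / ENNReal.ofReal (1 - δ) := by
  refine iSup₂_le fun x hx => ?_
  have h := norm_Phi_le hG hδ0 hδ1 hβ x
  rw [mem_sphere_zero_iff_norm.1 hx, mul_one, ← div_eq_mul_inv] at h
  rw [← ofReal_norm]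
  refine (ENNReal.ofReal_le_ofReal h).trans_eq ?_
  rw [ENNReal.ofReal_div_of_pos (by linarith), ENNReal.ofReal_toReal hβ.ne]

/-! ### Uniform convergence on bounded sets -/

theorem norm_seriesTerm_le_of_bound (hG : IsSelection A δ G) (hδ : 0 ≤ δ)
    (hβ : betaR.{u} δ < ∞) {R : ℝ} {x : Seq2 A} (hx : ‖x‖ ≤ R) (j : ℕ) :
    ‖seriesTerm G j x‖ ≤ (betaR.{u} δ).toReal * R * δ ^ j :=
  (norm_seriesTerm_le hG hδ hβ x j).trans
    (mul_le_mul_of_nonneg_right (mul_le_mul_of_nonneg_left hx ENNReal.toReal_nonneg)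
      (pow_nonneg hδ j))

/-- The Weierstrass M-test, with a geometric majorant depending only on a bound `R` for the set. -/
theorem tendstoUniformlyOn_seriesTerm (hG : IsSelection A δ G) (hδ0 : 0 ≤ δ) (hδ1 : δ < 1)
    (hβ : betaR.{u} δ < ∞) {s : Set (Seq2 A)} (hs : Bornology.IsBounded s) :
    TendstoUniformlyOn (fun (n : ℕ) x => ∑ j ∈ Finset.range n, ‖seriesTerm G j x‖)
        (fun x => ∑' j, ‖seriesTerm G j x‖) atTop s ∧
      TendstoUniformlyOn (fun (n : ℕ) x => ∑ j ∈ Finset.range n, seriesTerm G j x)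
        (Phi G) atTop s := by
  obtain ⟨R, hR⟩ := hs.exists_norm_le
  have hsum := (summable_geometric_of_lt_one hδ0 hδ1).mul_left ((betaR.{u} δ).toReal * R)
  refine ⟨tendstoUniformlyOn_tsum_nat hsum fun j x hx => ?_,
    tendstoUniformlyOn_tsum_nat hsum fun j x hx =>
      norm_seriesTerm_le_of_bound hG hδ0 hβ (hR x hx) j⟩
  rw [norm_norm]
  exact norm_seriesTerm_le_of_bound hG hδ0 hβ (hR x hx) j

/-! ### Homogeneity -/

theorem nextVec_smul {B : Type u} (c : ℂ) (g : LInf B) (x : Seq2 B) :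
    nextVec (c • g) (c • x) = c • nextVec g x := by
  ext F
  rw [seq2_smul_apply, nextVec_apply, nextVec_apply, fourier_LInf_smul]

theorem sigma_smul {B : Type u} {t : ℝ} (ht : 0 < t) (x : Seq2 B) :
    sigma ((t : ℂ) • x) = sigma x := by
  have h : ((t * ‖x‖)⁻¹ : ℝ) * t = ‖x‖⁻¹ := by
    rw [mul_inv, mul_comm t⁻¹, mul_assoc, inv_mul_cancel₀ ht.ne', mul_one]
  rw [sigma, sigma, norm_smul, Complex.norm_of_nonneg ht.le, smul_smul, ← Complex.ofReal_mul, h]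

theorem IsInterpolant.map_smul {B A' : Type u} {ι : B ↪ A'} {Γ : Seq2 B → LInf A'}
    (hΓ : IsInterpolant ι Γ) {t : ℝ} (ht : 0 < t) (x : Seq2 B) :
    Γ ((t : ℂ) • x) = (t : ℂ) • Γ x := by
  rcases eq_or_ne x 0 with rfl | hx
  · rw [smul_zero, hΓ.map_zero, smul_zero]
  · have htx : (t : ℂ) • x ≠ 0 := smul_ne_zero (by exact_mod_cast ht.ne') hx
    rw [hΓ.homog _ htx, hΓ.homog x hx, sigma_smul ht, norm_smul, Complex.norm_of_nonneg ht.le,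
      smul_smul, Complex.ofReal_mul]

/-- The maps `G j` need not be linear, but positive homogeneity passes through every step of the
cascade. -/
theorem vec_smul (hG : IsSelection A δ G) {t : ℝ} (ht : 0 < t) (x : Seq2 A) (j : ℕ) :
    vec G ((t : ℂ) • x) j = (t : ℂ) • vec G x j := by
  induction j with
  | zero => rfl
  | succ j ih =>
    change nextVec (G j (vec G ((t : ℂ) • x) j)) (vec G ((t : ℂ) • x) j) =
      (t : ℂ) • nextVec (G j (vec G x j)) (vec G x j)
    rw [ih, (hG.interpolant j).map_smul ht, nextVec_smul]

theorem Phi_smul (hG : IsSelection A δ G) (hδ0 : 0 ≤ δ) (hδ1 : δ < 1) (hβ : betaR.{u} δ < ∞)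
    {t : ℝ} (ht : 0 < t) (x : Seq2 A) : Phi G ((t : ℂ) • x) = (t : ℂ) • Phi G x := by
  refine (hasSum_seriesTerm hG hδ0 hδ1 hβ _).unique ?_
  have h : (fun j => seriesTerm G j ((t : ℂ) • x)) = fun j => (t : ℂ) • seriesTerm G j x := by
    funext j
    rw [seriesTerm, seriesTerm, vec_smul hG ht, (hG.interpolant j).map_smul ht, lift_smul,
      smul_comm]
  rw [h]
  exact (hasSum_seriesTerm hG hδ0 hδ1 hβ x).const_smul _

theorem Phi_zero (hG : IsSelection A δ G) (hδ0 : 0 ≤ δ) (hδ1 : δ < 1) (hβ : betaR.{u} δ < ∞) :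
    Phi G 0 = 0 := by
  have h := norm_Phi_le hG hδ0 hδ1 hβ 0
  rw [norm_zero, mul_zero, zero_mul] at h
  exact norm_le_zero_iff.1 h

/-! ### Interpolation and the Parseval formula for the sum of the series -/

theorem incl_apply_notMem_range {j k : ℕ} (hjk : j ≠ k) (a : cascade A k) :
    incl A k a ∉ Set.range (incl A j) := by
  rintro ⟨b, hb⟩
  exact hjk (congrArg Sigma.fst hb)

theorem fourier_Phi_base (hG : IsSelection A δ G) (hδ0 : 0 ≤ δ) (hδ1 : δ < 1)
    (hβ : betaR.{u} δ < ∞) (x : Seq2 A) (α : A) : fourier (Phi G x) {base A α} = x α := by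
  have h := (hasSum_seriesTerm hG hδ0 hδ1 hβ x).mapL
    ((pairing (Limit A)).flip (walshInf {base A α}))
  simp only [ContinuousLinearMap.flip_apply, pairing_walshInf] at h
  refine h.unique ?_
  have h0 : x α = fourier (seriesTerm G 0 x) {base A α} := by
    rw [seriesTerm, pow_zero, one_smul]
    exact ((fourier_lift_singleton (incl A 0) (G 0 (vec G x 0)) α).trans
      ((hG.interpolant 0).interp x α)).symm
  rw [h0]
  -- Terms of positive level do not depend on the coordinates in `A`.
  refine hasSum_single 0 fun j hj => ?_
  have h1 : fourier (lift (incl A j) (G j (vec G x j))) {base A α} = 0 :=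
    fourier_lift_of_notMem_range _ _ (Finset.mem_singleton_self _) (incl_apply_notMem_range hj α)
  rw [seriesTerm, fourier_LInf_smul, h1, mul_zero]

/-- This is the purpose of the powers of `𝔦`: without conjugation `𝔦^j 𝔦^j = (-1)^j`, so the second
dot product at level `j` cancels the first at level `j + 1`. -/
theorem pairing_seriesTerm (hG : IsSelection A δ G) (x y : Seq2 A) (j k : ℕ) :
    pairing (Limit A) (seriesTerm G j x) (seriesTerm G k y) =
      if j = k then (-1) ^ j * (dot (vec G x j) (vec G y j) +
        dot (vec G x (j + 1)) (vec G y (j + 1))) else 0 := by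
  rw [seriesTerm, seriesTerm, map_smul, map_smul, _root_.smul_apply, smul_smul,
    smul_eq_mul, pairing_apply]
  split_ifs with h
  · subst h
    rw [integral_lift_mul_lift, integral_mul_eq_dot_add_dot ((hG.interpolant j).interp _)
      ((hG.interpolant j).interp _) (hG.mean_zero j _), ← mul_pow, Complex.I_mul_I]
    rfl
  · rw [integral_lift_mul_lift_of_disjoint _ _ _ _ _ (hG.mean_zero j _), mul_zero]
    refine Set.disjoint_left.2 ?_
    rintro _ hr ⟨b, rfl⟩
    exact incl_apply_notMem_range h b hr

theorem pairing_partial_sums (hG : IsSelection A δ G) (x y : Seq2 A) (n : ℕ) :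
    pairing (Limit A) (∑ j ∈ Finset.range n, seriesTerm G j x)
      (∑ j ∈ Finset.range n, seriesTerm G j y) =
      dot x y - (-1) ^ n * dot (vec G x n) (vec G y n) := by
  have h1 : pairing (Limit A) (∑ j ∈ Finset.range n, seriesTerm G j x)
      (∑ j ∈ Finset.range n, seriesTerm G j y) =
      ∑ j ∈ Finset.range n, (-1) ^ j * (dot (vec G x j) (vec G y j) +
        dot (vec G x (j + 1)) (vec G y (j + 1))) := by
    simp only [map_sum, _root_.sum_apply, pairing_seriesTerm hG]
    refine Finset.sum_congr rfl fun k hk => ?_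
    rw [Finset.sum_ite_eq' (Finset.range n) k, if_pos hk]
  rw [h1]
  clear h1
  induction n with
  | zero =>
    rw [Finset.sum_range_zero, pow_zero, one_mul]
    exact (sub_self _).symm
  | succ n ih =>
    rw [Finset.sum_range_succ, ih, pow_succ]
    ring

theorem tendsto_dot_vec (hG : IsSelection A δ G) (hδ0 : 0 ≤ δ) (hδ1 : δ < 1) (x y : Seq2 A) :
    Tendsto (fun n => (-1) ^ n * dot (vec G x n) (vec G y n)) atTop (𝓝 0) := by
  have hlim : Tendsto (fun n : ℕ => δ ^ n * (‖x‖ * ‖y‖)) atTop (𝓝 0) := by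
    simpa using (tendsto_pow_atTop_nhds_zero_of_lt_one hδ0 hδ1).mul_const (‖x‖ * ‖y‖)
  refine squeeze_zero_norm (fun n => ?_) hlim
  rw [norm_mul, norm_pow, norm_neg, norm_one, one_pow, one_mul]
  have h1 := norm_vec_le hG hδ0 x n
  -- Decay of one factor suffices; the other need only stay bounded.
  have h2 : ‖vec G y n‖ ≤ ‖y‖ := (norm_vec_le hG hδ0 y n).trans
    (mul_le_of_le_one_left (norm_nonneg _) (pow_le_one₀ hδ0 hδ1.le))
  calc ‖dot (vec G x n) (vec G y n)‖ ≤ ‖vec G x n‖ * ‖vec G y n‖ := norm_dot_le _ _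
    _ ≤ (δ ^ n * ‖x‖) * ‖y‖ := by gcongr
    _ = δ ^ n * (‖x‖ * ‖y‖) := mul_assoc _ _ _

theorem integral_Phi_mul_Phi (hG : IsSelection A δ G) (hδ0 : 0 ≤ δ) (hδ1 : δ < 1)
    (hβ : betaR.{u} δ < ∞) (x y : Seq2 A) :
    ∫ ω, Phi G x ω * Phi G y ω ∂(P (Limit A)) = dot x y := by
  rw [← pairing_apply]
  have h1 := (hasSum_seriesTerm hG hδ0 hδ1 hβ x).tendsto_sum_nat
  have h2 := (hasSum_seriesTerm hG hδ0 hδ1 hβ y).tendsto_sum_nat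
  -- Joint continuity lets the square partial sums, with one `n` for both arguments, replace a
  -- double series.
  have h3 := ((pairing (Limit A)).continuous₂.tendsto (Phi G x, Phi G y)).comp
    (h1.prodMk_nhds h2)
  refine tendsto_nhds_unique h3 ?_
  have h4 : (fun n : ℕ => dot x y - (-1) ^ n * dot (vec G x n) (vec G y n)) =
      (Function.uncurry fun f g => pairing (Limit A) f g) ∘ fun n =>
        (∑ j ∈ Finset.range n, seriesTerm G j x, ∑ j ∈ Finset.range n, seriesTerm G j y) := by
    funext n
    exact (pairing_partial_sums hG x y n).symm
  refine h4 ▸ ?_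
  simpa using (tendsto_const_nhds (x := dot x y)).sub (tendsto_dot_vec hG hδ0 hδ1 x y)

theorem isUltraInterpolant_Phi (hG : IsSelection A δ G) (hδ0 : 0 ≤ δ) (hδ1 : δ < 1)
    (hβ : betaR.{u} δ < ∞) : IsUltraInterpolant (base A) (Phi G) := by
  have hfour := fourier_Phi_base hG hδ0 hδ1 hβ
  have hinj := injective_of_fourier (ι := base A) hfour
  have hzero := Phi_zero hG hδ0 hδ1 hβ
  have hhom : ∀ x : Seq2 A, x ≠ 0 → Phi G x = (‖x‖ : ℂ) • Phi G (sigma x) := fun x hx => by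
    rw [← Phi_smul hG hδ0 hδ1 hβ (norm_pos_iff.2 hx), norm_smul_sigma hx]
  refine ⟨⟨hinj, hzero, hhom, hfour⟩, hinj, hzero, hhom, fun x y => ?_, ?_⟩
  · rw [integral_Phi_mul_Phi hG hδ0 hδ1 hβ]
    exact hasSum_dot x y
  · refine (supNorm_Phi_le hG hδ0 hδ1 hβ).trans_lt (ENNReal.div_lt_top hβ.ne ?_)
    exact (ENNReal.ofReal_pos.2 (by linarith)).ne'

end

end UltraInterp

theorem theorem4p1 (A : Type u) (δ : ℝ) (hδ0 : 0 < δ) (hδ1 : δ < 1) :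
    betaR.{u} δ < ∞ ∧
    (∃ G : ∀ j, Seq2 (cascade A j) → LInf (cascade A j), IsSelection A δ G) ∧
    ∀ G : ∀ j, Seq2 (cascade A j) → LInf (cascade A j), IsSelection A δ G →
      (∀ x : Seq2 A, Summable (fun j => ‖seriesTerm G j x‖) ∧ HasSum (fun j => seriesTerm G j x) (Phi G x)) ∧
      (∀ s : Set (Seq2 A), Bornology.IsBounded s →
        TendstoUniformlyOn (fun (n : ℕ) x => ∑ j ∈ Finset.range n, ‖seriesTerm G j x‖)
          (fun x => ∑' j, ‖seriesTerm G j x‖) atTop s ∧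
        TendstoUniformlyOn (fun (n : ℕ) x => ∑ j ∈ Finset.range n, seriesTerm G j x)
          (Phi G) atTop s) ∧
      IsUltraInterpolant (base A) (Phi G) ∧
      supNorm (Phi G) ≤ betaR.{u} δ / ENNReal.ofReal (1 - δ) := by
  have hβ := betaR_lt_top.{u} hδ0 hδ1
  exact ⟨hβ, exists_isSelection A hδ0.le hβ, fun G hG =>
    ⟨fun x => ⟨summable_norm_seriesTerm hG hδ0.le hδ1 hβ x, hasSum_seriesTerm hG hδ0.le hδ1 hβ x⟩,
      fun s hs => tendstoUniformlyOn_seriesTerm hG hδ0.le hδ1 hβ hs,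
      isUltraInterpolant_Phi hG hδ0.le hδ1 hβ, supNorm_Phi_le hG hδ0.le hδ1 hβ⟩⟩
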